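/- Let $X$ be a separable complex Hilbert space and let $A$, with domain $D(A)\subset X$, be the generator of an exponentially stable $C_0$-semigroup $(T(t))_{t\ge 0}$ on $X$. Let $\mathcal H_\infty^-$ be the algebra of bounded analytic functions on the open left half-plane $\{s\in\mathbb C:\operatorname{Re}s<0\}$, with norm $\|g\|_\infty=\sup_{\operatorname{Re}s<0}|g(s)|$. Then there are constants $\gamma_A,\gamma$, depending only on the semigroup, and a linear map $g\mapsto g(A)$ from $\mathcal H_\infty^-$ to the linear operators $D(A)\to X$ with the following properties. (1) For every $g\in\mathcal H_\infty^-$ the operator $g(A)$ is bounded from $D(A)$, with the graph norm, to $X$, and it is infinite-time admissible: for all $x_0\in D(A)$ one has $g(A)T(\cdot)x_0\in L^2((0,\infty),X)$ and $$\int_0^\infty\|g(A)T(t)x_0\|^2\,dt\le\gamma_A\|g\|_\infty^2\|x_0\|^2 .$$ (2) For every $t>0$ the operator $g(A)T(t):D(A)\to X$ extends to a bounded operator on $X$, again denoted $g(A)T(t)$, and $$\|g(A)T(t)\|\le\frac{\gamma\,\|g\|_\infty}{\sqrt t}.$$ With this extension, the square integrability and the estimate in (1) hold for all $x_0\in X$.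 (3) The map $g\mapsto g(A)$ is a (possibly unbounded) functional calculus: $1(A)x=x$ for all $x\in D(A)$; for every $a\in\mathbb C$ with $\operatorname{Re}a>0$ the operator $aI-A$ is boundedly invertible, and the function $g(s)=1/(a-s)$ gives $g(A)x=(aI-A)^{-1}x$ for all $x\in D(A)$; and for all $g_1,g_2\in\mathcal H_\infty^-$ and $x\in D(A^2)$ one has $g_2(A)x\in D(A)$ and $(g_1g_2)(A)x=g_1(A)\,g_2(A)x$. (4) Let $g(i\,\cdot)$ denote the boundary function of $g$ on the imaginary axis, i.e. $g(i\omega)=\lim_{\varepsilon\downarrow0}g(-\varepsilon+i\omega)$ for almost every $\omega\in\mathbb R$. For every $x_0\in X$, the function $g(A)T(\cdot)x_0$ is the image of $T(\cdot)x_0$ under the Toeplitz operator on $L^2((0,\infty),X)$ with symbol $g$: extend $T(\cdot)x_0$ by zero to $\mathbb R$, multiply its Fourier transform by $g(i\,\cdot)$, apply the inverse Fourier transform, and restrict to $(0,\infty)$. -/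

import Mathlib

open Filter Topology MeasureTheory
open scoped FourierTransform

/-- `T` is a strongly continuous one-parameter semigroup of bounded operators on `X`. Only the
values `T t` with `0 ≤ t` matter. -/
structure IsC0Semigroup {X : Type*} [NormedAddCommGroup X] [NormedSpace ℂ X]
    (T : ℝ → X →L[ℂ] X) : Prop where
  map_zero : T 0 = ContinuousLinearMap.id ℂ X
  map_add : ∀ s t : ℝ, 0 ≤ s → 0 ≤ t → T (s + t) = (T s).comp (T t)
  continuousOn : ∀ x : X, ContinuousOn (fun t : ℝ => T t x) (Set.Ici 0)

/-- Exponential stability: `‖T t‖ ≤ M e^{-ω t}` for all `t ≥ 0`, with some `ω > 0`. -/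
def IsExponentiallyStable {X : Type*} [NormedAddCommGroup X] [NormedSpace ℂ X]
    (T : ℝ → X →L[ℂ] X) : Prop :=
  ∃ M ω : ℝ, 0 < ω ∧ ∀ t : ℝ, 0 ≤ t → ‖T t‖ ≤ M * Real.exp (-ω * t)

/-- `A` is the infinitesimal generator of `T`: `x ∈ D(A)` and `A x = y` if and only if
`(T h x - x) / h → y` as `h ↓ 0`. -/
def IsGenerator {X : Type*} [NormedAddCommGroup X] [NormedSpace ℂ X]
    (A : X →ₗ.[ℂ] X) (T : ℝ → X →L[ℂ] X) : Prop :=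
  ∀ x y : X, (x, y) ∈ A.graph ↔
    Tendsto (fun h : ℝ => (h : ℂ)⁻¹ • (T h x - x)) (𝓝[>] 0) (𝓝 y)

/-- The domain of the generator is invariant under the semigroup. -/
theorem IsGenerator.apply_mem_domain {X : Type*} [NormedAddCommGroup X] [NormedSpace ℂ X]
    {A : X →ₗ.[ℂ] X} {T : ℝ → X →L[ℂ] X} (hA : IsGenerator A T) (hT : IsC0Semigroup T)
    {x : X} (hx : x ∈ A.domain) {t : ℝ} (ht : 0 ≤ t) : T t x ∈ A.domain := by
  have h1 := (hA x (A ⟨x, hx⟩)).1 (A.mem_graph ⟨x, hx⟩)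
  have h2 : Tendsto (fun h : ℝ => (h : ℂ)⁻¹ • (T h (T t x) - T t x)) (𝓝[>] 0)
      (𝓝 (T t (A ⟨x, hx⟩))) := by
    refine (((T t).continuous.tendsto _).comp h1).congr' ?_
    filter_upwards [self_mem_nhdsWithin] with h hh
    have hh' : (0 : ℝ) ≤ h := le_of_lt hh
    have e1 : T h (T t x) = T t (T h x) := by
      rw [← ContinuousLinearMap.comp_apply, ← ContinuousLinearMap.comp_apply,
        ← hT.map_add h t hh' ht, ← hT.map_add t h ht hh', add_comm]
    simp [e1]
  exact LinearPMap.mem_domain_of_mem_graph ((hA _ _).2 h2)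

/-- The open left half-plane. -/
def leftHalfPlane : Set ℂ := {s : ℂ | s.re < 0}

/-- The algebra (under pointwise operations) of bounded analytic functions on the open left
half-plane. -/
def HInfMinus : Subalgebra ℂ (leftHalfPlane → ℂ) where
  carrier := {g | (∃ G : ℂ → ℂ, DifferentiableOn ℂ G leftHalfPlane ∧
      ∀ s : leftHalfPlane, g s = G s) ∧ ∃ C : ℝ, ∀ s : leftHalfPlane, ‖g s‖ ≤ C}
  mul_mem' := by
    rintro f g ⟨⟨F, hF, hfF⟩, C, hC⟩ ⟨⟨G, hG, hgG⟩, D, hD⟩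
    refine ⟨⟨fun s => F s * G s, hF.mul hG, fun s => by simp [hfF, hgG]⟩, C * D, fun s => ?_⟩
    rw [Pi.mul_apply, norm_mul]
    exact mul_le_mul (hC s) (hD s) (norm_nonneg _) ((norm_nonneg _).trans (hC s))
  add_mem' := by
    rintro f g ⟨⟨F, hF, hfF⟩, C, hC⟩ ⟨⟨G, hG, hgG⟩, D, hD⟩
    refine ⟨⟨fun s => F s + G s, hF.add hG, fun s => by simp [hfF, hgG]⟩, C + D, fun s => ?_⟩
    exact (norm_add_le _ _).trans (add_le_add (hC s) (hD s))
  algebraMap_mem' := fun r =>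
    ⟨⟨fun _ => r, differentiableOn_const r, fun _ => rfl⟩, ‖r‖, fun _ => le_rfl⟩

/-- The supremum norm `‖g‖_∞` on the open left half-plane. -/
noncomputable def hInfNorm (g : HInfMinus) : ℝ := ⨆ s : leftHalfPlane, ‖g.1 s‖

/-- The function `s ↦ 1 / (a - s)`, for `Re a > 0`. -/
noncomputable def invSubFun (a : ℂ) (ha : 0 < a.re) : HInfMinus :=
  ⟨fun s => (a - s)⁻¹, by
    have key : ∀ s : ℂ, s ∈ leftHalfPlane → a.re ≤ ‖a - s‖ := fun s hs => by
      have h1 : (a - s).re ≤ ‖a - s‖ := Complex.re_le_norm _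
      have h2 : s.re < 0 := hs
      rw [Complex.sub_re] at h1
      linarith
    refine ⟨⟨fun s => (a - s)⁻¹, ?_, fun _ => rfl⟩, a.re⁻¹, fun s => ?_⟩
    · refine DifferentiableOn.inv (by fun_prop) fun s hs => ?_
      exact norm_pos_iff.1 (lt_of_lt_of_le ha (key s hs))
    · rw [norm_inv]
      exact inv_anti₀ ha (key s s.2)⟩

/-- `b` is the boundary function of `g` on the imaginary axis: for almost every `ω`, `g(s)` tends
to `b(ω)` as `s → iω` horizontally from the left. (By Fatou's theorem every `g` has such a `b`,
unique up to null sets.) -/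
def IsBoundaryFunction (g : HInfMinus) (b : ℝ → ℂ) : Prop :=
  ∀ᵐ ω : ℝ, Tendsto (fun ε : Set.Ioi (0 : ℝ) =>
      g.1 ⟨-(ε : ℝ) + (ω : ℂ) * Complex.I, by
        have h : (0 : ℝ) < ε := ε.2
        simpa [leftHalfPlane] using h⟩)
    (comap Subtype.val (𝓝 0)) (𝓝 (b ω))

/-- `u = M_b f` in `L²((0,∞), X)`, where `M_b` is the Toeplitz operator with symbol `b`: extend `f`
by zero to the line, multiply its Fourier transform by `b`, transform back, and restrict to
`(0,∞)`. With Mathlib's normalization `(𝓕 f)(ξ) = ∫ e^{-2π i t ξ} f(t) dt`, the frequency `ξ`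
belongs to the point `2π i ξ` of the imaginary axis. -/
def IsToeplitzImage {X : Type*} [NormedAddCommGroup X] [InnerProductSpace ℂ X] [CompleteSpace X]
    (b : ℝ → ℂ) (f u : ℝ → X) : Prop :=
  ∃ F G : Lp X 2 (volume : Measure ℝ),
    F =ᵐ[volume] (Set.Ioi (0 : ℝ)).indicator f ∧
    (𝓕 G : Lp X 2 (volume : Measure ℝ)) =ᵐ[volume]
      (fun ξ : ℝ => b (2 * Real.pi * ξ) • (𝓕 F : Lp X 2 (volume : Measure ℝ)) ξ) ∧
    G =ᵐ[volume.restrict (Set.Ioi (0 : ℝ))] u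

/-- The value `C x` of an operator `C : D(A) → X` at `x ∈ D(A)`, and `0` at `x ∉ D(A)`. It is only
used at points of `D(A)`, such as `T t x` with `x ∈ D(A)` and `t ≥ 0`. -/
noncomputable def applyOnDomain {X : Type*} [NormedAddCommGroup X] [NormedSpace ℂ X]
    {A : X →ₗ.[ℂ] X} (C : A.domain →ₗ[ℂ] X) (x : X) : X :=
  open Classical in if h : x ∈ A.domain then C ⟨x, h⟩ else 0

/-- `C : D(A) → X` is bounded with respect to the graph norm of `A`. -/
def IsBoundedOnDomain {X : Type*} [NormedAddCommGroup X] [NormedSpace ℂ X]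
    {A : X →ₗ.[ℂ] X} (C : A.domain →ₗ[ℂ] X) : Prop :=
  ∃ K : ℝ, ∀ x : A.domain, ‖C x‖ ≤ K * (‖(x : X)‖ + ‖A x‖)

/-- `C : D(A) → X` is an (infinite-time) admissible output operator for `T`, with constant `m`:
`C T(·) x ∈ L²((0,∞), X)` and `∫₀^∞ ‖C T(t) x‖² dt ≤ m ‖x‖²` for all `x ∈ D(A)`. -/
def IsAdmissibleWith {X : Type*} [NormedAddCommGroup X] [NormedSpace ℂ X]
    {A : X →ₗ.[ℂ] X} (T : ℝ → X →L[ℂ] X) (C : A.domain →ₗ[ℂ] X) (m : ℝ) : Prop :=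
  ∀ x : A.domain,
    MemLp (fun t : ℝ => applyOnDomain C (T t x)) 2 (volume.restrict (Set.Ioi (0 : ℝ))) ∧
    ∫ t in Set.Ioi (0 : ℝ), ‖applyOnDomain C (T t x)‖ ^ 2 ≤ m * ‖(x : X)‖ ^ 2

/-- `R = (a I - A)⁻¹` is the bounded inverse of `a I - A : D(A) → X`. -/
def IsResolventAt {X : Type*} [NormedAddCommGroup X] [NormedSpace ℂ X]
    (A : X →ₗ.[ℂ] X) (a : ℂ) (R : X →L[ℂ] X) : Prop :=
  (∀ x : X, ∃ h : R x ∈ A.domain, a • R x - A ⟨R x, h⟩ = x) ∧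
  ∀ y : A.domain, R (a • (y : X) - A y) = y

/-- The linear map `g ↦ g(A) = Φ g`, from bounded analytic functions on the left half-plane to
operators `D(A) → X`, is a (possibly unbounded) functional calculus for `A`. -/
structure IsHInfCalculus {X : Type*} [NormedAddCommGroup X] [NormedSpace ℂ X]
    (A : X →ₗ.[ℂ] X) (Φ : HInfMinus →ₗ[ℂ] (A.domain →ₗ[ℂ] X)) : Prop where
  /-- The constant function `1` is mapped to the identity. -/
  map_one : ∀ x : A.domain, Φ 1 x = x
  /-- The function `s ↦ 1 / (a - s)` is mapped to `(a I - A)⁻¹`. -/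
  map_resolvent : ∀ (a : ℂ) (ha : 0 < a.re), ∃ R : X →L[ℂ] X, IsResolventAt A a R ∧
    ∀ x : A.domain, Φ (invSubFun a ha) x = R x
  /-- On `D(A²)`, `(g₁ g₂)(A) = g₁(A) g₂(A)`; in particular `g₂(A)` maps `D(A²)` into `D(A)`. -/
  map_mul : ∀ (g₁ g₂ : HInfMinus) (x : A.domain), A x ∈ A.domain →
    ∃ h : Φ g₂ x ∈ A.domain, Φ (g₁ * g₂) x = Φ g₁ ⟨Φ g₂ x, h⟩

/-! Suppose first that `k` is holomorphic on `Re s < 0` and decays quadratically along vertical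
lines. Then `k(s) = ∫₀^∞ e^{st} h(t) dt` with a bounded kernel `h`, and `k(A) = ∫₀^∞ h(t) T(t) dt`
is a bounded operator. For `-ω < c < 0` the weighted orbit `e^{-ct} T(t)x` is still in `L²`. By
`decayCalc_orbit`, `k(A)T(t)x` is `e^{ct}` times the inverse Fourier transform of `k(c + 2πiξ)`
times the transform of that orbit. Plancherel then bounds `k(A)T(·)x` in `L²` by a multiple of `sup
|k| ‖x‖`, with no other dependence on `k` (`exists_admissible_bound`). As `k(A)` commutes with the
semigroup, the `L²` bound yields a `t^{-1/2}` bound (`norm_orbit_le_of_eLpNorm_le`). Integrating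
this against `e^{-t}` bounds `k(A)(1 - A)⁻¹` (`norm_semOp_exp_le`).

A general `g` is approximated by `gₙ(s) = (n+1)²/(n+1-s)² g(s)`, which decays quadratically and has
no larger supremum, so these bounds are uniform in `n`. On the dense range of `(1 - A)⁻²` the
operators `gₙ(A)` converge, because `(1-s)⁻² g(s)` itself decays quadratically. Hence `gₙ(A)T(t)`
and `gₙ(A)(1 - A)⁻¹` converge strongly on all of `X` (`exists_strong_limit`), to `S t` and to `N`.
One sets `g(A)x = N(x - Ax)` on `D(A)`.

Multiplicativity comes from the product rule for decaying functions (`decayCalc_mul`) by passing to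
the limit (`resolvent_limit_mul`). For the Toeplitz property, `c ↑ 0` in the orbit formula for `gₙ`
produces the boundary values of `gₙ`. Then `n → ∞` in `L²` gives the symbol `g` (`isToeplitzImage`).
-/

/-! ### The `L²` Fourier transform on `L¹ ∩ L²`. -/

section FourierL2

variable {X : Type*} [NormedAddCommGroup X] [InnerProductSpace ℂ X] [CompleteSpace X]

/-- On `L¹ ∩ L²` the `L²` Fourier transform is the Fourier integral. -/
theorem MeasureTheory.MemLp.fourier_toLp_ae_eq {f : ℝ → X} (hf1 : Integrable f) (hf2 : MemLp f 2) :
    (𝓕 (hf2.toLp f) : Lp X 2 (volume : Measure ℝ)) =ᵐ[volume] 𝓕 f := by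
  have hcont : Continuous (𝓕 f) := VectorFourier.fourierIntegral_continuous
    Real.continuous_fourierChar (by fun_prop) hf1
  have hloc : LocallyIntegrable (𝓕 (hf2.toLp f) : Lp X 2 (volume : Measure ℝ)) volume :=
    (Lp.memLp _).locallyIntegrable (by norm_num)
  -- Both sides are tested against a smooth compactly supported function. Seen as a Schwartz
  -- function, it takes over the Fourier transform: by duality of tempered distributions on the
  -- left, by the multiplication formula on the right.
  refine ae_eq_of_integral_contDiff_smul_eq hloc hcont.locallyIntegrable fun g hg hgc => ?_
  let G : ℝ → ℂ := fun x => (g x : ℂ)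
  have hGc : HasCompactSupport G := hgc.comp_left (g := fun r : ℝ => (r : ℂ)) (by simp)
  have hGd : ContDiff ℝ (⊤ : ℕ∞) G := Complex.ofRealCLM.contDiff.comp hg
  let φ : SchwartzMap ℝ ℂ := hGc.toSchwartzMap hGd
  have e1 : (𝓕 (Lp.toTemperedDistribution (hf2.toLp f))) φ =
      (Lp.toTemperedDistribution (𝓕 (hf2.toLp f))) φ := by
    rw [Lp.fourier_toTemperedDistribution_eq]
  rw [TemperedDistribution.fourier_apply, Lp.toTemperedDistribution_apply,
    Lp.toTemperedDistribution_apply] at e1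
  have e2 : ∫ x, (𝓕 φ) x • (hf2.toLp f) x = ∫ x, (𝓕 (φ : ℝ → ℂ)) x • f x := by
    refine integral_congr_ae ?_
    filter_upwards [hf2.coeFn_toLp] with x hx
    rw [hx, SchwartzMap.fourier_coe]
  have e3 : ∫ x, (𝓕 (φ : ℝ → ℂ)) x • f x = ∫ x, φ x • 𝓕 f x := by
    have := VectorFourier.integral_fourierIntegral_smul_eq_flip (μ := volume) (ν := volume)
      (L := innerₗ ℝ) (f := φ) (g := f)
      Real.continuous_fourierChar (by fun_prop) φ.integrable hf1
    rw [flip_innerₗ] at this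
    exact this
  have hφ : ∀ x, φ x = (g x : ℂ) := fun x => rfl
  rw [e2, e3] at e1
  simpa [hφ] using e1.symm

/-- On `L¹ ∩ L²` the inverse `L²` Fourier transform is the inverse Fourier integral. -/
theorem MeasureTheory.MemLp.fourierInv_toLp_ae_eq {f : ℝ → X} (hf1 : Integrable f)
    (hf2 : MemLp f 2) :
    (𝓕⁻ (hf2.toLp f) : Lp X 2 (volume : Measure ℝ)) =ᵐ[volume] 𝓕⁻ f := by
  have hcont : Continuous (𝓕⁻ f) := VectorFourier.fourierIntegral_continuous
    Real.continuous_fourierChar (by fun_prop) hf1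
  have hloc : LocallyIntegrable (𝓕⁻ (hf2.toLp f) : Lp X 2 (volume : Measure ℝ)) volume :=
    (Lp.memLp _).locallyIntegrable (by norm_num)
  refine ae_eq_of_integral_contDiff_smul_eq hloc hcont.locallyIntegrable fun g hg hgc => ?_
  let G : ℝ → ℂ := fun x => (g x : ℂ)
  have hGc : HasCompactSupport G := hgc.comp_left (g := fun r : ℝ => (r : ℂ)) (by simp)
  have hGd : ContDiff ℝ (⊤ : ℕ∞) G := Complex.ofRealCLM.contDiff.comp hg
  let φ : SchwartzMap ℝ ℂ := hGc.toSchwartzMap hGd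
  have e1 : (𝓕⁻ (Lp.toTemperedDistribution (hf2.toLp f))) φ =
      (Lp.toTemperedDistribution (𝓕⁻ (hf2.toLp f))) φ := by
    rw [Lp.fourierInv_toTemperedDistribution_eq]
  rw [TemperedDistribution.fourierInv_apply, Lp.toTemperedDistribution_apply,
    Lp.toTemperedDistribution_apply] at e1
  have e2 : ∫ x, (𝓕⁻ φ) x • (hf2.toLp f) x = ∫ x, (𝓕⁻ (φ : ℝ → ℂ)) x • f x := by
    refine integral_congr_ae ?_
    filter_upwards [hf2.coeFn_toLp] with x hx
    rw [hx, SchwartzMap.fourierInv_coe]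
  have e3 : ∫ x, (𝓕⁻ (φ : ℝ → ℂ)) x • f x = ∫ x, φ x • 𝓕⁻ f x := by
    have := VectorFourier.integral_fourierIntegral_smul_eq_flip (μ := volume) (ν := volume)
      (L := -innerₗ ℝ) (f := φ) (g := f)
      Real.continuous_fourierChar (by fun_prop) φ.integrable hf1
    rw [show (-innerₗ ℝ).flip = -innerₗ ℝ by ext; simp] at this
    exact this
  have hφ : ∀ x, φ x = (g x : ℂ) := fun x => rfl
  rw [e2, e3] at e1
  simpa [hφ] using e1.symm

end FourierL2

/-! ### Weighted integrals of a stable semigroup and Laplace transforms of its orbits. -/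

section Semigroup

variable {X : Type*} [NormedAddCommGroup X] [NormedSpace ℂ X]

/-- A strongly continuous semigroup with `‖T t‖ ≤ M e^{-ω t}`, `ω > 0`. -/
structure IsStableSemigroup (T : ℝ → X →L[ℂ] X) (M ω : ℝ) : Prop extends IsC0Semigroup T where
  pos : 0 < ω
  norm_le : ∀ t : ℝ, 0 ≤ t → ‖T t‖ ≤ M * Real.exp (-ω * t)

/-- The bounded operator `x ↦ ∫₀^∞ φ(t) T(t) x dt` (`0` if this is not bounded). -/
noncomputable def semOp (T : ℝ → X →L[ℂ] X) (φ : ℝ → ℂ) : X →L[ℂ] X :=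
  open Classical in
  if h : ∃ L : X →L[ℂ] X, ∀ x, L x = ∫ t in Set.Ioi (0 : ℝ), φ t • T t x then h.choose else 0

/-- `φ` is integrable on `(0,∞)` against the weight `e^{-ω t}`. -/
def WeightedIntegrable (ω : ℝ) (φ : ℝ → ℂ) : Prop :=
  IntegrableOn (fun t => (Real.exp (-ω * t) : ℂ) * φ t) (Set.Ioi 0)

/-- The Laplace transform of the orbit of `x`. -/
noncomputable def orbitLaplace (T : ℝ → X →L[ℂ] X) (x : X) (s : ℂ) : X :=
  ∫ t in Set.Ioi (0 : ℝ), Complex.exp (-s * t) • T t x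

/-- The orbit of `x` with weight `e^{-c t}`, extended by zero to the real line. -/
noncomputable def cutOrbit (T : ℝ → X →L[ℂ] X) (c : ℝ) (x : X) : ℝ → X :=
  (Set.Ioi (0 : ℝ)).indicator fun t => Complex.exp (-c * t) • T t x

theorem WeightedIntegrable.aestronglyMeasurable {ω : ℝ} {φ : ℝ → ℂ}
    (h : WeightedIntegrable ω φ) :
    AEStronglyMeasurable φ (volume.restrict (Set.Ioi 0)) := by
  have h1 : AEStronglyMeasurable (fun t : ℝ => (Real.exp (ω * t) : ℂ))
      (volume.restrict (Set.Ioi 0)) := by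
    apply Continuous.aestronglyMeasurable; fun_prop
  refine (h1.mul h.1).congr (Eventually.of_forall fun t => ?_)
  have : Real.exp (ω * t) * Real.exp (-ω * t) = 1 := by rw [← Real.exp_add]; simp
  simp only [Pi.mul_apply]
  rw [← mul_assoc, ← Complex.ofReal_mul, this]; simp

theorem weightedIntegrable_of_norm_le {ω δ C : ℝ} (hδ : δ < ω) {φ : ℝ → ℂ}
    (hm : AEStronglyMeasurable φ (volume.restrict (Set.Ioi 0)))
    (h : ∀ t : ℝ, 0 < t → ‖φ t‖ ≤ C * Real.exp (δ * t)) : WeightedIntegrable ω φ := by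
  have hi : IntegrableOn (fun t : ℝ => C * Real.exp (-(ω - δ) * t)) (Set.Ioi 0) :=
    (exp_neg_integrableOn_Ioi 0 (by linarith)).const_mul C
  refine hi.mono' (AEStronglyMeasurable.mul ?_ hm) ?_
  · apply Continuous.aestronglyMeasurable; fun_prop
  · filter_upwards [ae_restrict_mem measurableSet_Ioi] with t ht
    rw [norm_mul, Complex.norm_real, Real.norm_of_nonneg (Real.exp_nonneg _)]
    calc Real.exp (-ω * t) * ‖φ t‖ ≤ Real.exp (-ω * t) * (C * Real.exp (δ * t)) := by
          gcongr; exact h t ht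
      _ = C * Real.exp (-(ω - δ) * t) := by
          rw [mul_left_comm, ← Real.exp_add]; ring_nf

theorem weightedIntegrable_cexp {ω : ℝ} {s : ℂ} (hs : -ω < s.re) :
    WeightedIntegrable ω fun t => Complex.exp (-s * t) := by
  refine weightedIntegrable_of_norm_le (δ := -s.re) (C := 1) (by linarith) ?_ fun t _ => ?_
  · apply Continuous.aestronglyMeasurable; fun_prop
  · rw [Complex.norm_exp]; simp

namespace IsStableSemigroup

variable {T : ℝ → X →L[ℂ] X} {M ω : ℝ}

theorem nonneg (hT : IsStableSemigroup T M ω) : 0 ≤ M := by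
  have := (norm_nonneg _).trans (hT.norm_le 0 le_rfl)
  simpa using this

theorem norm_apply_le (hT : IsStableSemigroup T M ω) {t : ℝ} (ht : 0 ≤ t) (x : X) :
    ‖T t x‖ ≤ M * Real.exp (-ω * t) * ‖x‖ :=
  (T t).le_of_opNorm_le (hT.norm_le t ht) x

theorem norm_le_const (hT : IsStableSemigroup T M ω) {t : ℝ} (ht : 0 ≤ t) : ‖T t‖ ≤ M := by
  refine (hT.norm_le t ht).trans (mul_le_of_le_one_right hT.nonneg ?_)
  rw [Real.exp_le_one_iff]
  nlinarith [hT.pos]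

theorem apply_add (hT : IsStableSemigroup T M ω) {s t : ℝ} (hs : 0 ≤ s) (ht : 0 ≤ t) (x : X) :
    T (s + t) x = T s (T t x) := by
  rw [hT.map_add s t hs ht]; rfl

theorem apply_comm (hT : IsStableSemigroup T M ω) {s t : ℝ} (hs : 0 ≤ s) (ht : 0 ≤ t) (x : X) :
    T s (T t x) = T t (T s x) := by
  rw [← hT.apply_add hs ht, ← hT.apply_add ht hs, add_comm]

theorem aestronglyMeasurable (hT : IsStableSemigroup T M ω) (x : X) :
    AEStronglyMeasurable (fun t => T t x) (volume.restrict (Set.Ioi 0)) :=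
  ((hT.continuousOn x).mono Set.Ioi_subset_Ici_self).aestronglyMeasurable measurableSet_Ioi

theorem norm_smul_le (hT : IsStableSemigroup T M ω) (φ : ℝ → ℂ) {t : ℝ} (ht : 0 ≤ t) (x : X) :
    ‖φ t • T t x‖ ≤ (M * ‖x‖) * ‖(Real.exp (-ω * t) : ℂ) * φ t‖ := by
  rw [norm_smul, norm_mul, Complex.norm_real, Real.norm_of_nonneg (Real.exp_nonneg _)]
  calc ‖φ t‖ * ‖T t x‖ ≤ ‖φ t‖ * (M * Real.exp (-ω * t) * ‖x‖) := by
        gcongr; exact hT.norm_apply_le ht x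
    _ = _ := by ring

theorem integrableOn_smul (hT : IsStableSemigroup T M ω) {φ : ℝ → ℂ}
    (hφ : WeightedIntegrable ω φ) (x : X) :
    IntegrableOn (fun t => φ t • T t x) (Set.Ioi 0) := by
  refine (hφ.norm.const_mul (M * ‖x‖)).mono'
    (hφ.aestronglyMeasurable.smul (hT.aestronglyMeasurable x)) ?_
  filter_upwards [ae_restrict_mem measurableSet_Ioi] with t ht
  exact hT.norm_smul_le φ (le_of_lt ht) x

theorem norm_integral_smul_le (hT : IsStableSemigroup T M ω) {φ : ℝ → ℂ}
    (hφ : WeightedIntegrable ω φ) (x : X) :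
    ‖∫ t in Set.Ioi (0 : ℝ), φ t • T t x‖ ≤
      M * (∫ t in Set.Ioi (0 : ℝ), ‖(Real.exp (-ω * t) : ℂ) * φ t‖) * ‖x‖ := by
  have := norm_integral_le_of_norm_le (hφ.norm.const_mul (M * ‖x‖)) (f := fun t => φ t • T t x)
    ((ae_restrict_mem measurableSet_Ioi).mono fun t ht => hT.norm_smul_le φ (le_of_lt ht) x)
  rw [integral_const_mul] at this
  linarith

theorem semOp_apply (hT : IsStableSemigroup T M ω) {φ : ℝ → ℂ} (hφ : WeightedIntegrable ω φ)
    (x : X) : semOp T φ x = ∫ t in Set.Ioi (0 : ℝ), φ t • T t x := by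
  have h : ∃ L : X →L[ℂ] X, ∀ x, L x = ∫ t in Set.Ioi (0 : ℝ), φ t • T t x := by
    refine ⟨LinearMap.mkContinuous
      { toFun := fun x => ∫ t in Set.Ioi (0 : ℝ), φ t • T t x
        map_add' := fun x y => ?_
        map_smul' := fun a x => ?_ } _ (hT.norm_integral_smul_le hφ), fun x => rfl⟩
    · rw [← integral_add (hT.integrableOn_smul hφ x) (hT.integrableOn_smul hφ y)]
      simp
    · simp only [map_smul, RingHom.id_apply]
      rw [← integral_smul]
      simp_rw [smul_comm a]
  rw [semOp, dif_pos h]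
  exact h.choose_spec x

theorem integral_norm_weight_cexp {s : ℂ} (hs : -ω < s.re) :
    ∫ t in Set.Ioi (0 : ℝ), ‖(Real.exp (-ω * t) : ℂ) * Complex.exp (-s * t)‖ = (ω + s.re)⁻¹ := by
  have : ∀ t : ℝ, ‖(Real.exp (-ω * t) : ℂ) * Complex.exp (-s * t)‖
      = Real.exp (-(ω + s.re) * t) := fun t => by
    rw [norm_mul, Complex.norm_real, Real.norm_of_nonneg (Real.exp_nonneg _), Complex.norm_exp,
      ← Real.exp_add]
    congr 1
    simp; ring
  simp_rw [this]
  rw [integral_exp_mul_Ioi (by linarith)]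
  simp only [mul_zero, Real.exp_zero]
  rw [neg_div_neg_eq, one_div]

theorem norm_orbitLaplace_le (hT : IsStableSemigroup T M ω) {s : ℂ} (hs : -ω < s.re) (x : X) :
    ‖orbitLaplace T x s‖ ≤ M * (ω + s.re)⁻¹ * ‖x‖ := by
  have := hT.norm_integral_smul_le (weightedIntegrable_cexp hs) x
  rwa [integral_norm_weight_cexp hs] at this

theorem semOp_comm [CompleteSpace X] (hT : IsStableSemigroup T M ω) {φ : ℝ → ℂ}
    (hφ : WeightedIntegrable ω φ)
    {t : ℝ} (ht : 0 ≤ t) (x : X) : semOp T φ (T t x) = T t (semOp T φ x) := by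
  rw [hT.semOp_apply hφ, hT.semOp_apply hφ,
    ← ContinuousLinearMap.integral_comp_comm _ (hT.integrableOn_smul hφ x)]
  refine setIntegral_congr_fun measurableSet_Ioi fun τ hτ => ?_
  simp only [map_smul]
  rw [hT.apply_comm ht (le_of_lt hτ)]

theorem integrable_cutOrbit (hT : IsStableSemigroup T M ω) {c : ℝ} (hc : -ω < c) (x : X) :
    Integrable (cutOrbit T c x) := by
  rw [cutOrbit, integrable_indicator_iff measurableSet_Ioi]
  exact hT.integrableOn_smul (weightedIntegrable_cexp (by simpa using hc)) x

/-- The weight `e^{-ct}` and the Fourier character combine to `e^{-st}` with `s = c + 2πiξ`. This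
links `L²` Fourier analysis of orbits to analysis on the line `Re s = c`. -/
theorem fourier_cutOrbit (T : ℝ → X →L[ℂ] X) (c : ℝ) (x : X) (ξ : ℝ) :
    𝓕 (cutOrbit T c x) ξ = orbitLaplace T x (c + 2 * Real.pi * ξ * Complex.I) := by
  rw [Real.fourier_real_eq_integral_exp_smul, orbitLaplace, ← integral_indicator measurableSet_Ioi]
  refine integral_congr_ae (Eventually.of_forall fun t => ?_)
  by_cases ht : t ∈ Set.Ioi (0 : ℝ)
  · simp only [cutOrbit, Set.indicator_of_mem ht]
    rw [smul_smul, ← Complex.exp_add]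
    congr 2
    push_cast; ring
  · simp [cutOrbit, Set.indicator_of_notMem ht]

theorem exists_eLpNorm_cutOrbit_le (hT : IsStableSemigroup T M ω) {c : ℝ} (hc : -ω < c) :
    ∃ B : ℝ, 0 ≤ B ∧ ∀ x : X, MemLp (cutOrbit T c x) 2 ∧
      eLpNorm (cutOrbit T c x) 2 volume ≤ ENNReal.ofReal (B * ‖x‖) := by
  -- A scalar majorant of the weighted orbit up to the factor `M ‖x‖`; it is square integrable
  -- because `ω + c > 0`. Its norm times `M` is the constant `B`.
  let w : ℝ → ℝ := (Set.Ioi (0 : ℝ)).indicator fun t => Real.exp (-(ω + c) * t)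
  have hw : MemLp w 2 := by
    rw [memLp_indicator_iff_restrict measurableSet_Ioi, memLp_two_iff_integrable_sq]
    · refine (exp_neg_integrableOn_Ioi 0 (b := 2 * (ω + c)) (by linarith)).congr_fun
        (fun t _ => ?_) measurableSet_Ioi
      simp only [pow_two]
      rw [← Real.exp_add]; ring_nf
    · apply Continuous.aestronglyMeasurable; fun_prop
  refine ⟨M * (eLpNorm w 2 volume).toReal, mul_nonneg hT.nonneg ENNReal.toReal_nonneg, fun x => ?_⟩
  have hle : ∀ t, ‖cutOrbit T c x t‖ ≤ (M * ‖x‖) * ‖w t‖ := fun t => by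
    by_cases ht : t ∈ Set.Ioi (0 : ℝ)
    · have := hT.norm_smul_le (fun t => Complex.exp (-c * t)) (le_of_lt ht) x
      simp only [cutOrbit, w, Set.indicator_of_mem ht]
      refine this.trans_eq ?_
      congr 1
      rw [norm_mul, Complex.norm_real, Complex.norm_exp, Real.norm_of_nonneg (Real.exp_nonneg _),
        Real.norm_of_nonneg (Real.exp_nonneg _), ← Real.exp_add]
      congr 1
      simp; ring
    · simp [cutOrbit, w, Set.indicator_of_notMem ht]
  refine ⟨hw.of_le_mul (hT.integrable_cutOrbit hc x).1 (Eventually.of_forall hle), ?_⟩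
  refine (eLpNorm_le_mul_eLpNorm_of_ae_le_mul (Eventually.of_forall hle) 2).trans_eq ?_
  rw [mul_right_comm, ENNReal.ofReal_mul (mul_nonneg hT.nonneg (norm_nonneg _)),
    ENNReal.ofReal_toReal hw.2.ne]

end IsStableSemigroup

end Semigroup

/-! ### Inverse Laplace transforms of functions with quadratic decay. -/

section Kernel

/-- The point with frequency `ξ` on the vertical line `Re s = c`. -/
noncomputable def vline (c ξ : ℝ) : ℂ := c + 2 * Real.pi * ξ * Complex.I

@[simp] theorem vline_re (c ξ : ℝ) : (vline c ξ).re = c := by simp [vline]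

@[simp] theorem vline_im (c ξ : ℝ) : (vline c ξ).im = 2 * Real.pi * ξ := by simp [vline]

@[fun_prop] theorem continuous_vline (c : ℝ) : Continuous (vline c) := by
  unfold vline; fun_prop

/-- The constant `∫ (1 + (2πξ)²)⁻¹ dξ`. -/
noncomputable def lineConst : ℝ := ∫ ξ : ℝ, (1 + (2 * Real.pi * ξ) ^ 2)⁻¹

theorem integrable_lineWeight : Integrable fun ξ : ℝ => (1 + (2 * Real.pi * ξ) ^ 2)⁻¹ :=
  integrable_inv_one_add_sq.comp_mul_left' (by positivity : (2 * Real.pi) ≠ 0)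

/-- Holomorphic functions with quadratic decay have the same integral over two vertical lines. -/
theorem integral_vline_eq {F : ℂ → ℂ} (hF : DifferentiableOn ℂ F leftHalfPlane) {c₁ c₂ D : ℝ}
    (h12 : c₁ ≤ c₂) (h2 : c₂ < 0)
    (hD : ∀ s : ℂ, c₁ ≤ s.re → s.re ≤ c₂ → ‖F s‖ ≤ D * (1 + s.im ^ 2)⁻¹) :
    ∫ ξ : ℝ, F (vline c₁ ξ) = ∫ ξ : ℝ, F (vline c₂ ξ) := by
  have hint : ∀ c, c₁ ≤ c → c ≤ c₂ → Integrable fun y : ℝ => F (c + y * Complex.I) := by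
    intro c h h'
    refine (integrable_inv_one_add_sq.const_mul D).mono' ?_ (Eventually.of_forall fun y => ?_)
    · apply Continuous.aestronglyMeasurable
      refine hF.continuousOn.comp_continuous (by fun_prop) fun y => ?_
      simpa [leftHalfPlane] using lt_of_le_of_lt h' h2
    · simpa using hD (c + y * Complex.I) (by simpa using h) (by simpa using h')
  have hlim : ∀ c, c₁ ≤ c → c ≤ c₂ → Tendsto (fun R : ℝ => ∫ y : ℝ in -R..R,
      F (c + y * Complex.I)) atTop (𝓝 (∫ y : ℝ, F (c + y * Complex.I))) := fun c h h' =>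
    intervalIntegral_tendsto_integral (hint c h h') tendsto_neg_atTop_atBot tendsto_id
  have hdecay : Tendsto (fun R : ℝ => (1 + R ^ 2)⁻¹) atTop (𝓝 0) :=
    tendsto_inv_atTop_zero.comp
      (tendsto_atTop_add_const_left _ _ (tendsto_pow_atTop two_ne_zero))
  -- The function `u` stands for `R` or `-R`, so both horizontal edges of the rectangle are treated
  -- at once.
  have hhor : ∀ u : ℝ → ℝ, (∀ R, u R ^ 2 = R ^ 2) → Tendsto (fun R : ℝ => ∫ x : ℝ in c₁..c₂,
      F (x + u R * Complex.I)) atTop (𝓝 0) := by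
    intro u hu
    have hb : ∀ R : ℝ, ‖∫ x : ℝ in c₁..c₂, F (x + u R * Complex.I)‖
        ≤ D * (1 + R ^ 2)⁻¹ * |c₂ - c₁| := fun R => by
      refine intervalIntegral.norm_integral_le_of_norm_le_const fun x hx => ?_
      rw [Set.uIoc_of_le h12] at hx
      simpa [hu] using hD (x + u R * Complex.I) (by simpa using hx.1.le) (by simpa using hx.2)
    refine squeeze_zero_norm hb ?_
    simpa using (hdecay.const_mul D).mul_const |c₂ - c₁|
  have hrect : ∀ R : ℝ, (∫ x : ℝ in c₁..c₂, F (x + ((-R : ℝ) : ℂ) * Complex.I))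
      - (∫ x : ℝ in c₁..c₂, F (x + (R : ℂ) * Complex.I))
      + Complex.I • (∫ y : ℝ in -R..R, F (c₂ + y * Complex.I))
      - Complex.I • (∫ y : ℝ in -R..R, F (c₁ + y * Complex.I)) = 0 := fun R => by
    have := Complex.integral_boundary_rect_eq_zero_of_differentiableOn F
      (⟨c₁, -R⟩ : ℂ) (⟨c₂, R⟩ : ℂ) (hF.mono ?_)
    · simpa using this
    · rintro s ⟨hs, -⟩
      simp only [Set.mem_preimage, Set.uIcc_of_le h12] at hs
      exact lt_of_le_of_lt hs.2 h2
  have hzero : (0 : ℂ) - 0 + Complex.I • (∫ y : ℝ, F (c₂ + y * Complex.I))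
      - Complex.I • (∫ y : ℝ, F (c₁ + y * Complex.I)) = 0 := by
    refine tendsto_nhds_unique ((((hhor (fun R => -R) (by simp)).sub
      (hhor (fun R => R) (by simp))).add ((hlim c₂ h12 le_rfl).const_smul _)).sub
      ((hlim c₁ le_rfl h12).const_smul _)) ?_
    simp_rw [hrect]
    exact tendsto_const_nhds
  have heq : ∫ y : ℝ, F (c₁ + y * Complex.I) = ∫ y : ℝ, F (c₂ + y * Complex.I) := by
    have h3 := mul_left_cancel₀ Complex.I_ne_zero (sub_eq_zero.1 (by simpa using hzero))
    exact h3.symm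
  have hscale : ∀ c : ℝ, ∫ ξ : ℝ, F (vline c ξ) =
      |(2 * Real.pi)⁻¹| • ∫ y : ℝ, F (c + y * Complex.I) := fun c => by
    rw [← Measure.integral_comp_mul_left (fun y : ℝ => F (c + y * Complex.I))]
    simp [vline]
  rw [hscale, hscale, heq]

/-- Holomorphic functions on the left half-plane that decay quadratically along vertical lines. -/
structure IsDecaying (k : ℂ → ℂ) (C : ℝ) : Prop where
  differentiableOn : DifferentiableOn ℂ k leftHalfPlane
  norm_le : ∀ s : ℂ, s.re < 0 → ‖k s‖ ≤ C * (1 + s.im ^ 2)⁻¹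

/-- The function on `(0,∞)` whose Laplace transform `∫₀^∞ e^{st} h(t) dt` is `k`. -/
noncomputable def kernel (k : ℂ → ℂ) (t : ℝ) : ℂ :=
  ∫ ξ : ℝ, k (vline (-1) ξ) * Complex.exp (-(vline (-1) ξ) * t)

theorem kernel_congr {k₁ k₂ : ℂ → ℂ} (h : ∀ s : ℂ, s.re < 0 → k₁ s = k₂ s) :
    kernel k₁ = kernel k₂ := by
  funext t
  unfold kernel
  congr 1
  funext ξ
  rw [h _ (by simp)]

namespace IsDecaying

variable {k k₁ k₂ : ℂ → ℂ} {C C₁ C₂ : ℝ}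

theorem const_nonneg (hk : IsDecaying k C) : 0 ≤ C := by
  have := (norm_nonneg _).trans (hk.norm_le (-1) (by simp))
  simpa using this

theorem continuous_vline (hk : IsDecaying k C) {c : ℝ} (hc : c < 0) :
    Continuous fun ξ => k (vline c ξ) :=
  hk.differentiableOn.continuousOn.comp_continuous (by fun_prop) fun ξ => by
    simpa [leftHalfPlane] using hc

theorem norm_vline_le (hk : IsDecaying k C) {c : ℝ} (hc : c < 0) (ξ : ℝ) :
    ‖k (vline c ξ)‖ ≤ C * (1 + (2 * Real.pi * ξ) ^ 2)⁻¹ := by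
  simpa using hk.norm_le (vline c ξ) (by simpa using hc)

theorem integrable_vline (hk : IsDecaying k C) {c : ℝ} (hc : c < 0) :
    Integrable fun ξ => k (vline c ξ) :=
  (integrable_lineWeight.const_mul C).mono' (hk.continuous_vline hc).aestronglyMeasurable
    (Eventually.of_forall (hk.norm_vline_le hc))

theorem norm_exp_vline (c ξ t : ℝ) : ‖Complex.exp (-(vline c ξ) * t)‖ = Real.exp (-c * t) := by
  rw [Complex.norm_exp]; simp

/-- Cauchy's theorem: the line `Re s = -1` in the definition is only a choice. Freedom in `c` gives
boundedness of the kernel (`c ↑ 0`) and its support (`c → -∞`). -/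
theorem kernel_eq (hk : IsDecaying k C) {c : ℝ} (hc : c < 0) (t : ℝ) :
    kernel k t = ∫ ξ : ℝ, k (vline c ξ) * Complex.exp (-(vline c ξ) * t) := by
  have key : ∀ c₁ c₂ : ℝ, c₁ ≤ c₂ → c₂ < 0 →
      ∫ ξ : ℝ, k (vline c₁ ξ) * Complex.exp (-(vline c₁ ξ) * t) =
      ∫ ξ : ℝ, k (vline c₂ ξ) * Complex.exp (-(vline c₂ ξ) * t) := by
    intro c₁ c₂ h12 h2
    -- The sign of `t` is arbitrary. Since `|e^{-st}|` is monotone in `Re s`, its maximum over the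
    -- strip is attained on one of the two bounding lines.
    refine integral_vline_eq (F := fun s => k s * Complex.exp (-s * t))
      (D := C * max (Real.exp (-c₁ * t)) (Real.exp (-c₂ * t))) ?_ h12 h2 fun s h1 h2' => ?_
    · exact hk.differentiableOn.mul (by fun_prop)
    · rw [norm_mul, Complex.norm_exp, mul_right_comm]
      refine mul_le_mul (hk.norm_le s (lt_of_le_of_lt h2' h2)) ?_ (Real.exp_nonneg _)
        (mul_nonneg hk.const_nonneg (by positivity))
      have hre : (-s * (t : ℂ)).re = -s.re * t := by simp
      rw [hre]
      rcases le_total 0 t with ht | ht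
      · exact le_max_of_le_left (Real.exp_le_exp.2 (by nlinarith))
      · exact le_max_of_le_right (Real.exp_le_exp.2 (by nlinarith))
  rcases le_total (-1) c with h | h
  · exact key _ _ h hc
  · exact (key _ _ h (by norm_num)).symm

theorem fourier_vline (hk : IsDecaying k C) {c : ℝ} (hc : c < 0) (t : ℝ) :
    𝓕 (fun ξ => k (vline c ξ)) t = Complex.exp (c * t) * kernel k t := by
  rw [hk.kernel_eq hc, Real.fourier_real_eq_integral_exp_smul, ← integral_const_mul]
  congr 1
  funext ξ
  rw [smul_eq_mul, mul_left_comm, ← Complex.exp_add, mul_comm]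
  congr 2
  unfold vline; push_cast; ring

theorem continuous_kernel (hk : IsDecaying k C) : Continuous (kernel k) := by
  have h1 : kernel k = fun t : ℝ =>
      Complex.exp t * 𝓕 (fun ξ => k (vline (-1) ξ)) t := by
    funext t
    rw [hk.fourier_vline (by norm_num), ← mul_assoc, ← Complex.exp_add]
    simp
  rw [h1]
  have : Continuous (𝓕 fun ξ => k (vline (-1) ξ)) := VectorFourier.fourierIntegral_continuous
    Real.continuous_fourierChar (by fun_prop) (hk.integrable_vline (by norm_num))
  fun_prop

theorem norm_kernel_le_exp (hk : IsDecaying k C) {c : ℝ} (hc : c < 0) (t : ℝ) :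
    ‖kernel k t‖ ≤ C * lineConst * Real.exp (-c * t) := by
  rw [hk.kernel_eq hc, lineConst, ← integral_const_mul, ← integral_mul_const]
  refine norm_integral_le_of_norm_le ((integrable_lineWeight.const_mul C).mul_const _)
    (Eventually.of_forall fun ξ => ?_)
  rw [norm_mul, norm_exp_vline]
  exact mul_le_mul_of_nonneg_right (hk.norm_vline_le hc ξ) (Real.exp_nonneg _)

theorem norm_kernel_le (hk : IsDecaying k C) (t : ℝ) : ‖kernel k t‖ ≤ C * lineConst := by
  have h : Tendsto (fun c : ℝ => C * lineConst * Real.exp (-c * t)) (𝓝[<] 0)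
      (𝓝 (C * lineConst * Real.exp (-0 * t))) :=
    (Continuous.tendsto (by fun_prop) 0).mono_left nhdsWithin_le_nhds
  simp only [neg_zero, zero_mul, Real.exp_zero, mul_one] at h
  exact ge_of_tendsto h (eventually_mem_nhdsWithin.mono fun c hc => hk.norm_kernel_le_exp hc t)

/-- A Paley–Wiener argument: for `t < 0` the bound `C * lineConst * e^{-ct}` tends to zero as `c →
-∞`. The point `t = 0` follows by continuity. -/
theorem kernel_of_nonpos (hk : IsDecaying k C) {t : ℝ} (ht : t ≤ 0) : kernel k t = 0 := by
  have hneg : Set.EqOn (kernel k) (fun _ => 0) (Set.Iio 0) := by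
    intro t ht
    have h1 : Tendsto (fun c : ℝ => C * lineConst * Real.exp (-c * t)) atBot
        (𝓝 (C * lineConst * 0)) := by
      refine (Real.tendsto_exp_atBot.comp ?_).const_mul _
      have h2 : Tendsto (fun c : ℝ => c * (-t)) atBot atBot :=
        tendsto_id.atBot_mul_const (by simpa using ht)
      exact h2.congr fun c => by ring
    rw [mul_zero] at h1
    refine norm_le_zero_iff.1 (ge_of_tendsto h1 ?_)
    filter_upwards [eventually_lt_atBot (0 : ℝ)] with c hc
    exact hk.norm_kernel_le_exp hc t
  have := hneg.closure hk.continuous_kernel continuous_const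
  rw [closure_Iio] at this
  exact this ht

theorem weightedIntegrable_kernel (hk : IsDecaying k C) {ω : ℝ} (hω : 0 < ω) :
    WeightedIntegrable ω (kernel k) :=
  weightedIntegrable_of_norm_le (δ := 0) (C := C * lineConst) hω
    hk.continuous_kernel.aestronglyMeasurable fun t _ => by simpa using hk.norm_kernel_le t

/-- `k` is the Laplace transform of its kernel. -/
theorem laplace_kernel (hk : IsDecaying k C) {c : ℝ} (hc : c < 0) (ξ : ℝ) :
    ∫ t in Set.Ioi (0 : ℝ), kernel k t * Complex.exp (vline c ξ * t) = k (vline c ξ) := by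
  have hF : 𝓕 (fun ξ => k (vline c ξ)) =
      (Set.Ioi (0 : ℝ)).indicator fun t : ℝ => Complex.exp (c * t) * kernel k t := by
    funext t
    rw [hk.fourier_vline hc]
    by_cases ht : t ∈ Set.Ioi (0 : ℝ)
    · rw [Set.indicator_of_mem ht]
    · rw [Set.indicator_of_notMem ht, hk.kernel_of_nonpos (not_lt.1 ht), mul_zero]
  -- The transform is supported on `t > 0` and is `e^{ct}` times a bounded function there. Being
  -- integrable, it admits Fourier inversion.
  have hFi : Integrable (𝓕 fun ξ => k (vline c ξ)) := by
    rw [hF, integrable_indicator_iff measurableSet_Ioi]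
    have := hk.weightedIntegrable_kernel (ω := -c) (by linarith)
    simpa [WeightedIntegrable] using this
  have hinv := congrFun ((hk.continuous_vline hc).fourierInv_fourier_eq
    (hk.integrable_vline hc) hFi) ξ
  rw [← hinv, Real.fourierInv_eq', hF, ← integral_indicator measurableSet_Ioi]
  congr 1
  funext t
  by_cases ht : t ∈ Set.Ioi (0 : ℝ)
  · simp only [Set.indicator_of_mem ht]
    rw [smul_eq_mul, ← mul_assoc, ← Complex.exp_add, mul_comm]
    congr 2
    unfold vline; simp; ring
  · simp [Set.indicator_of_notMem ht]

theorem add (h₁ : IsDecaying k₁ C₁) (h₂ : IsDecaying k₂ C₂) :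
    IsDecaying (fun s => k₁ s + k₂ s) (C₁ + C₂) where
  differentiableOn := h₁.differentiableOn.add h₂.differentiableOn
  norm_le s hs := by
    rw [add_mul]
    exact (norm_add_le _ _).trans (add_le_add (h₁.norm_le s hs) (h₂.norm_le s hs))

theorem mul_bounded (hk : IsDecaying k C) {g : ℂ → ℂ} {m : ℝ}
    (hg : DifferentiableOn ℂ g leftHalfPlane) (hm : ∀ s : ℂ, s.re < 0 → ‖g s‖ ≤ m) :
    IsDecaying (fun s => g s * k s) (m * C) where
  differentiableOn := hg.mul hk.differentiableOn
  norm_le s hs := by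
    rw [norm_mul, mul_assoc]
    exact mul_le_mul (hm s hs) (hk.norm_le s hs) (norm_nonneg _) ((norm_nonneg _).trans (hm s hs))

theorem kernel_add (h₁ : IsDecaying k₁ C₁) (h₂ : IsDecaying k₂ C₂) (t : ℝ) :
    kernel (fun s => k₁ s + k₂ s) t = kernel k₁ t + kernel k₂ t := by
  have hi : ∀ {k : ℂ → ℂ} {C : ℝ}, IsDecaying k C → Integrable fun ξ : ℝ =>
      k (vline (-1) ξ) * Complex.exp (-(vline (-1) ξ) * t) := fun {k C} hk => by
    refine (hk.integrable_vline (by norm_num)).mul_bdd (c := Real.exp (-(-1) * t)) ?_ ?_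
    · apply Continuous.aestronglyMeasurable; fun_prop
    · exact Eventually.of_forall fun ξ => (norm_exp_vline _ _ _).le
  unfold kernel
  rw [← integral_add (hi h₁) (hi h₂)]
  simp_rw [add_mul]

theorem kernel_const_mul (a : ℂ) (k : ℂ → ℂ) (t : ℝ) :
    kernel (fun s => a * k s) t = a * kernel k t := by
  unfold kernel
  rw [← integral_const_mul]
  simp_rw [mul_assoc]

end IsDecaying

end Kernel

/-! ### The calculus for decaying functions: orbit formula, products, resolvents, limits. -/

section Calculus

/-- The operator `k(A) = ∫₀^∞ h(t) T(t) dt`, where `h` is the kernel of `k`. -/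
noncomputable def decayCalc {X : Type*} [NormedAddCommGroup X] [NormedSpace ℂ X]
    (T : ℝ → X →L[ℂ] X) (k : ℂ → ℂ) : X →L[ℂ] X := semOp T (kernel k)

theorem decayCalc_congr {X : Type*} [NormedAddCommGroup X] [NormedSpace ℂ X]
    (T : ℝ → X →L[ℂ] X) {k₁ k₂ : ℂ → ℂ} (h : ∀ s : ℂ, s.re < 0 → k₁ s = k₂ s) :
    decayCalc T k₁ = decayCalc T k₂ := by
  rw [decayCalc, decayCalc, kernel_congr h]

namespace IsStableSemigroup

variable {X : Type*} [NormedAddCommGroup X] [NormedSpace ℂ X]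
  {T : ℝ → X →L[ℂ] X} {M ω : ℝ} {k k₁ k₂ : ℂ → ℂ} {C C₁ C₂ : ℝ}

theorem decayCalc_apply (hT : IsStableSemigroup T M ω) (hk : IsDecaying k C) (x : X) :
    decayCalc T k x = ∫ t in Set.Ioi (0 : ℝ), kernel k t • T t x :=
  hT.semOp_apply (hk.weightedIntegrable_kernel hT.pos) x

theorem decayCalc_add (hT : IsStableSemigroup T M ω) (h₁ : IsDecaying k₁ C₁)
    (h₂ : IsDecaying k₂ C₂) (x : X) :
    decayCalc T (fun s => k₁ s + k₂ s) x = decayCalc T k₁ x + decayCalc T k₂ x := by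
  rw [hT.decayCalc_apply (h₁.add h₂), hT.decayCalc_apply h₁, hT.decayCalc_apply h₂,
    ← integral_add (hT.integrableOn_smul (h₁.weightedIntegrable_kernel hT.pos) x)
      (hT.integrableOn_smul (h₂.weightedIntegrable_kernel hT.pos) x)]
  simp_rw [h₁.kernel_add h₂, add_smul]

theorem decayCalc_const_mul (hT : IsStableSemigroup T M ω) (hk : IsDecaying k C) (a : ℂ) (x : X) :
    decayCalc T (fun s => a * k s) x = a • decayCalc T k x := by
  have hak : IsDecaying (fun s => a * k s) (‖a‖ * C) :=
    hk.mul_bounded (differentiableOn_const a) fun _ _ => le_rfl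
  rw [hT.decayCalc_apply hak, hT.decayCalc_apply hk, ← integral_smul]
  simp_rw [IsDecaying.kernel_const_mul, mul_smul]

theorem decayCalc_comm [CompleteSpace X] (hT : IsStableSemigroup T M ω) (hk : IsDecaying k C)
    {t : ℝ} (ht : 0 ≤ t) (x : X) : decayCalc T k (T t x) = T t (decayCalc T k x) :=
  hT.semOp_comm (hk.weightedIntegrable_kernel hT.pos) ht x

theorem decayCalc_semOp_comm [CompleteSpace X] (hT : IsStableSemigroup T M ω)
    (hk : IsDecaying k C) {φ : ℝ → ℂ} (hφ : WeightedIntegrable ω φ) (x : X) :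
    decayCalc T k (semOp T φ x) = semOp T φ (decayCalc T k x) := by
  rw [hT.semOp_apply hφ, hT.semOp_apply hφ,
    ← ContinuousLinearMap.integral_comp_comm _ (hT.integrableOn_smul hφ x)]
  refine setIntegral_congr_fun measurableSet_Ioi fun t ht => ?_
  simp only [map_smul]
  rw [hT.decayCalc_comm hk (le_of_lt ht)]

/-- The orbit of `k(A)` as an inverse Fourier integral over a vertical line. -/
theorem decayCalc_orbit [CompleteSpace X] (hT : IsStableSemigroup T M ω) (hk : IsDecaying k C)
    {c : ℝ} (hc : -ω < c) (hc0 : c < 0) {t : ℝ} (ht : 0 ≤ t) (x : X) :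
    decayCalc T k (T t x) =
      Complex.exp (c * t) • 𝓕⁻ (fun ξ => k (vline c ξ) • 𝓕 (cutOrbit T c x) ξ) t := by
  -- The multiplication formula moves the transform from the orbit to `e^{2πitξ} k(c + 2πiξ)`. That
  -- transform at `τ` is `e^{c(τ-t)} h(τ - t)`, with `h` the kernel of `k`. It vanishes for `τ ≤ t`,
  -- so exactly the shifted integral for `k(A)T(t)x` remains.
  have hflip := VectorFourier.integral_fourierIntegral_smul_eq_flip (μ := volume) (ν := volume)
    (L := innerₗ ℝ) (f := fun ξ : ℝ => Complex.exp (2 * Real.pi * t * ξ * Complex.I) *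
      k (vline c ξ)) (g := cutOrbit T c x) Real.continuous_fourierChar (by fun_prop) ?_
      (hT.integrable_cutOrbit hc x)
  · rw [flip_innerₗ] at hflip
    have hR : 𝓕⁻ (fun ξ => k (vline c ξ) • 𝓕 (cutOrbit T c x) ξ) t =
        ∫ ξ : ℝ, (Complex.exp (2 * Real.pi * t * ξ * Complex.I) * k (vline c ξ)) •
          VectorFourier.fourierIntegral Real.fourierChar volume (innerₗ ℝ) (cutOrbit T c x) ξ := by
      rw [Real.fourierInv_eq']
      congr 1
      funext ξ
      rw [mul_smul]
      congr 2
      simp; ring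
    rw [hR, ← hflip, ← integral_smul, hT.decayCalc_apply hk]
    have hshift : ∫ τ in Set.Ioi (0 : ℝ), kernel k τ • T τ (T t x) =
        ∫ τ in Set.Ioi t, kernel k (τ - t) • T τ x := by
      have := ((measurePreserving_add_right (volume : Measure ℝ) t).setIntegral_preimage_emb
        (measurableEmbedding_addRight t) (fun τ => kernel k (τ - t) • T τ x) (Set.Ioi t))
      rw [Set.preimage_add_const_Ioi, sub_self] at this
      rw [← this]
      refine setIntegral_congr_fun measurableSet_Ioi fun τ hτ => ?_
      simp only [add_sub_cancel_right]
      rw [hT.apply_add (le_of_lt hτ) ht]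
    rw [hshift, ← integral_indicator measurableSet_Ioi]
    congr 1
    funext τ
    have hFour : VectorFourier.fourierIntegral Real.fourierChar volume (innerₗ ℝ)
        (fun ξ : ℝ => Complex.exp (2 * Real.pi * t * ξ * Complex.I) * k (vline c ξ)) τ =
        Complex.exp (c * (τ - t)) * kernel k (τ - t) := by
      have := hk.fourier_vline hc0 (τ - t)
      push_cast at this
      rw [← this]
      change 𝓕 (fun ξ : ℝ => Complex.exp (2 * Real.pi * t * ξ * Complex.I) *
        k (vline c ξ)) τ = _
      rw [Real.fourier_real_eq_integral_exp_smul, Real.fourier_real_eq_integral_exp_smul]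
      congr 1
      funext ξ
      rw [smul_eq_mul, smul_eq_mul, ← mul_assoc, ← Complex.exp_add]
      congr 2
      push_cast; ring
    rw [hFour]
    by_cases hτ : τ ∈ Set.Ioi t
    · have hτ0 : τ ∈ Set.Ioi (0 : ℝ) := lt_of_le_of_lt ht hτ
      simp only [cutOrbit, Set.indicator_of_mem hτ, Set.indicator_of_mem hτ0, smul_smul]
      congr 1
      rw [mul_right_comm, mul_comm _ (kernel k _), ← Complex.exp_add, mul_left_comm,
        ← Complex.exp_add]
      ring_nf
      simp
    · have : kernel k (τ - t) = 0 := hk.kernel_of_nonpos (by simpa using hτ)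
      simp [Set.indicator_of_notMem hτ, this]
  · refine (hk.integrable_vline hc0).bdd_mul (c := 1) ?_ (Eventually.of_forall fun ξ => ?_)
    · apply Continuous.aestronglyMeasurable; fun_prop
    · rw [Complex.norm_exp]; simp

theorem norm_fourier_cutOrbit_le (hT : IsStableSemigroup T M ω) {c : ℝ} (hc : -ω < c) (x : X)
    (ξ : ℝ) : ‖𝓕 (cutOrbit T c x) ξ‖ ≤ M * (ω + c)⁻¹ * ‖x‖ := by
  rw [fourier_cutOrbit]
  simpa using hT.norm_orbitLaplace_le (s := c + 2 * Real.pi * ξ * Complex.I) (by simpa using hc) x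

theorem continuous_fourier_cutOrbit (hT : IsStableSemigroup T M ω) {c : ℝ} (hc : -ω < c) (x : X) :
    Continuous (𝓕 (cutOrbit T c x)) :=
  VectorFourier.fourierIntegral_continuous Real.continuous_fourierChar (by fun_prop)
    (hT.integrable_cutOrbit hc x)

theorem integrable_vline_smul (hT : IsStableSemigroup T M ω) (hk : IsDecaying k C)
    {c : ℝ} (hc : -ω < c) (hc0 : c < 0) (x : X) :
    Integrable fun ξ => k (vline c ξ) • 𝓕 (cutOrbit T c x) ξ :=
  (hk.integrable_vline hc0).smul_bdd (M * (ω + c)⁻¹ * ‖x‖)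
    (hT.continuous_fourier_cutOrbit hc x).aestronglyMeasurable
    (Eventually.of_forall (hT.norm_fourier_cutOrbit_le hc x))

theorem decayCalc_eq_integral [CompleteSpace X] (hT : IsStableSemigroup T M ω)
    (hk : IsDecaying k C) {c : ℝ} (hc : -ω < c) (hc0 : c < 0) (x : X) :
    decayCalc T k x = ∫ ξ, k (vline c ξ) • 𝓕 (cutOrbit T c x) ξ := by
  have := hT.decayCalc_orbit hk hc hc0 le_rfl x
  rw [hT.map_zero] at this
  simpa [Real.fourierInv_eq'] using this

/-- If `φ` has Laplace transform `p`, then `k(A) ∫₀^∞ φ(t) T(t) dt = (p k)(A)`. -/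
theorem decayCalc_semOp [CompleteSpace X] (hT : IsStableSemigroup T M ω) (hk : IsDecaying k C)
    {c : ℝ} (hc : -ω < c) (hc0 : c < 0) {φ : ℝ → ℂ} (hφ : WeightedIntegrable (-c) φ)
    (hφω : WeightedIntegrable ω φ) {p : ℂ → ℂ} {D : ℝ}
    (hp : ∀ ξ : ℝ, ∫ t in Set.Ioi (0 : ℝ), φ t * Complex.exp (vline c ξ * t) = p (vline c ξ))
    (hpk : IsDecaying (fun s => p s * k s) D) (x : X) :
    decayCalc T k (semOp T φ x) = decayCalc T (fun s => p s * k s) x := by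
  rw [hT.decayCalc_eq_integral hpk hc hc0, hT.semOp_apply hφω,
    ← ContinuousLinearMap.integral_comp_comm _ (hT.integrableOn_smul hφω x)]
  have hf : Integrable ((Set.Ioi (0 : ℝ)).indicator fun t => Complex.exp (c * t) * φ t) := by
    rw [integrable_indicator_iff measurableSet_Ioi]
    simpa [WeightedIntegrable] using hφ
  -- The negated pairing turns this into the multiplication formula for the inverse transform. On
  -- one side `e^{ct} φ(t)` becomes `p` on the line `Re s = c`; on the other side the orbit formula
  -- for `k(A)T(t)x` appears.
  have hflip := VectorFourier.integral_fourierIntegral_smul_eq_flip (μ := volume) (ν := volume)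
    (L := -innerₗ ℝ) (f := (Set.Ioi (0 : ℝ)).indicator fun t => Complex.exp (c * t) * φ t)
    (g := fun ξ => k (vline c ξ) • 𝓕 (cutOrbit T c x) ξ)
    Real.continuous_fourierChar (by fun_prop) hf (hT.integrable_vline_smul hk hc hc0 x)
  rw [show (-innerₗ ℝ).flip = -innerₗ ℝ by ext; simp] at hflip
  have hL : ∀ ξ, VectorFourier.fourierIntegral Real.fourierChar volume (-innerₗ ℝ)
      ((Set.Ioi (0 : ℝ)).indicator fun t => Complex.exp (c * t) * φ t) ξ = p (vline c ξ) := by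
    intro ξ
    change 𝓕⁻ ((Set.Ioi (0 : ℝ)).indicator fun t => Complex.exp (c * t) * φ t) ξ = _
    rw [← hp, Real.fourierInv_eq', ← integral_indicator measurableSet_Ioi]
    congr 1
    funext t
    by_cases ht : t ∈ Set.Ioi (0 : ℝ)
    · simp only [Set.indicator_of_mem ht]
      rw [smul_eq_mul, ← mul_assoc, ← Complex.exp_add, mul_comm]
      congr 2
      unfold vline; simp; ring
    · simp [Set.indicator_of_notMem ht]
  simp_rw [hL, smul_smul] at hflip
  rw [hflip, ← integral_indicator measurableSet_Ioi]
  congr 1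
  funext t
  by_cases ht : t ∈ Set.Ioi (0 : ℝ)
  · simp only [Set.indicator_of_mem ht, map_smul]
    rw [hT.decayCalc_orbit hk hc hc0 (le_of_lt ht), smul_smul, mul_comm]
    rfl
  · simp [Set.indicator_of_notMem ht]

/-- The case of `decayCalc_semOp` in which `φ` is the kernel of `k₂`, whose Laplace transform is
`k₂` by `laplace_kernel`. -/
theorem decayCalc_mul [CompleteSpace X] (hT : IsStableSemigroup T M ω) (h₁ : IsDecaying k₁ C₁)
    (h₂ : IsDecaying k₂ C₂) (x : X) :
    decayCalc T k₁ (decayCalc T k₂ x) = decayCalc T (fun s => k₂ s * k₁ s) x := by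
  have hω := hT.pos
  have hc : -ω < -(ω / 2) := by linarith
  have hc0 : -(ω / 2) < 0 := by linarith
  have h12 : IsDecaying (fun s => k₂ s * k₁ s) (C₂ * C₁) := by
    refine h₁.mul_bounded h₂.differentiableOn fun s hs => ?_
    refine (h₂.norm_le s hs).trans (mul_le_of_le_one_right h₂.const_nonneg ?_)
    exact inv_le_one_of_one_le₀ (by nlinarith [sq_nonneg s.im])
  exact hT.decayCalc_semOp h₁ hc hc0 (h₂.weightedIntegrable_kernel (by linarith))
    (h₂.weightedIntegrable_kernel hω) (h₂.laplace_kernel hc0) h12 x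

/-- The resolvent operator `(a - A)⁻¹ = ∫₀^∞ e^{-at} T(t) dt`. -/
theorem decayCalc_resolvent [CompleteSpace X] (hT : IsStableSemigroup T M ω)
    (hk : IsDecaying k C) {a : ℂ} (ha : 0 < a.re) {D : ℝ}
    (hak : IsDecaying (fun s => (a - s)⁻¹ * k s) D) (x : X) :
    decayCalc T k (semOp T (fun t => Complex.exp (-a * t)) x) =
      decayCalc T (fun s => (a - s)⁻¹ * k s) x := by
  have hω := hT.pos
  refine hT.decayCalc_semOp hk (c := -(ω / 2)) (by linarith) (by linarith)
    (weightedIntegrable_cexp (by linarith)) (weightedIntegrable_cexp (by linarith))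
    (p := fun s => (a - s)⁻¹) (fun ξ => ?_) hak x
  have hre : (vline (-(ω / 2)) ξ - a).re < 0 := by simp; linarith
  have hne : vline (-(ω / 2)) ξ - a ≠ 0 := fun h => by rw [h] at hre; simp at hre
  have := integral_exp_mul_complex_Ioi hre 0
  rw [← neg_sub, inv_neg]
  simp_rw [← Complex.exp_add]
  simp only [Complex.ofReal_zero, mul_zero, Complex.exp_zero, neg_div, one_div] at this
  rw [← this]
  congr 1
  funext t
  congr 1; ring

/-- Dominated convergence for the operators `k(A)`. -/
theorem tendsto_decayCalc [CompleteSpace X] (hT : IsStableSemigroup T M ω) {f : ℕ → ℂ → ℂ}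
    (hf : ∀ n, IsDecaying (f n) C) (hk : IsDecaying k C₁)
    (hlim : ∀ s : ℂ, s.re < 0 → Tendsto (fun n => f n s) atTop (𝓝 (k s))) (x : X) :
    Tendsto (fun n => decayCalc T (f n) x) atTop (𝓝 (decayCalc T k x)) := by
  have hω := hT.pos
  have hc : -ω < -(ω / 2) := by linarith
  have hc0 : -(ω / 2) < 0 := by linarith
  simp_rw [hT.decayCalc_eq_integral hk hc hc0, fun n => hT.decayCalc_eq_integral (hf n) hc hc0]
  refine tendsto_integral_of_dominated_convergence
    (fun ξ => C * (1 + (2 * Real.pi * ξ) ^ 2)⁻¹ * (M * (ω + -(ω / 2))⁻¹ * ‖x‖))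
    (fun n => (hT.integrable_vline_smul (hf n) hc hc0 x).1)
    ((integrable_lineWeight.const_mul C).mul_const _) (fun n => Eventually.of_forall fun ξ => ?_)
    (Eventually.of_forall fun ξ => (hlim _ (by simpa using hω)).smul_const _)
  rw [norm_smul]
  exact mul_le_mul ((hf n).norm_vline_le hc0 ξ) (hT.norm_fourier_cutOrbit_le hc x ξ)
    (norm_nonneg _) (mul_nonneg (hf n).const_nonneg (by positivity))

end IsStableSemigroup

end Calculus

/-! ### Plancherel for Fourier integrals. -/

section Plancherel

variable {X : Type*} [NormedAddCommGroup X] [InnerProductSpace ℂ X] [CompleteSpace X]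

theorem MeasureTheory.MemLp.memLp_fourier {f : ℝ → X} (hf1 : Integrable f) (hf2 : MemLp f 2) :
    MemLp (𝓕 f) 2 ∧ eLpNorm (𝓕 f) 2 volume = eLpNorm f 2 volume := by
  have h := hf2.fourier_toLp_ae_eq hf1
  refine ⟨(Lp.memLp _).ae_eq h, ?_⟩
  rw [← eLpNorm_congr_ae h, ← eLpNorm_congr_ae hf2.coeFn_toLp, ← Lp.enorm_def, ← Lp.enorm_def,
    ← ofReal_norm, ← ofReal_norm, Lp.norm_fourier_eq]

theorem MeasureTheory.MemLp.memLp_fourierInv {f : ℝ → X} (hf1 : Integrable f) (hf2 : MemLp f 2) :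
    MemLp (𝓕⁻ f) 2 ∧ eLpNorm (𝓕⁻ f) 2 volume = eLpNorm f 2 volume := by
  have h := hf2.fourierInv_toLp_ae_eq hf1
  refine ⟨(Lp.memLp _).ae_eq h, ?_⟩
  rw [← eLpNorm_congr_ae h, ← eLpNorm_congr_ae hf2.coeFn_toLp, ← Lp.enorm_def, ← Lp.enorm_def,
    ← ofReal_norm, ← ofReal_norm, show ‖𝓕⁻ (hf2.toLp f)‖ = ‖hf2.toLp f‖ from
      (Lp.fourierTransformₗᵢ ℝ X).symm.norm_map _]

end Plancherel

/-! ### Bounds by the supremum norm alone. -/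

section Bounds

/-- The resolvent `(a - A)⁻¹` as a Laplace transform of the semigroup. -/
noncomputable def laplaceResolvent {X : Type*} [NormedAddCommGroup X] [NormedSpace ℂ X]
    (T : ℝ → X →L[ℂ] X) (a : ℂ) : X →L[ℂ] X := semOp T fun t => Complex.exp (-a * t)

namespace IsStableSemigroup

variable {X : Type*} [NormedAddCommGroup X] [InnerProductSpace ℂ X]
  {T : ℝ → X →L[ℂ] X} {M ω : ℝ}

/-- Admissibility of `k(A)`, with a bound that only depends on `sup ‖k‖`. -/
theorem exists_admissible_bound [CompleteSpace X] (hT : IsStableSemigroup T M ω) :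
    ∃ B : ℝ, 0 ≤ B ∧ ∀ (k : ℂ → ℂ) (C m : ℝ), IsDecaying k C →
      (∀ s : ℂ, s.re < 0 → ‖k s‖ ≤ m) → ∀ x : X,
      AEStronglyMeasurable (fun t => decayCalc T k (T t x)) (volume.restrict (Set.Ioi 0)) ∧
      eLpNorm (fun t => decayCalc T k (T t x)) 2 (volume.restrict (Set.Ioi 0)) ≤
        ENNReal.ofReal (B * m * ‖x‖) := by
  have hω := hT.pos
  have hc : -ω < -(ω / 2) := by linarith
  have hc0 : -(ω / 2) < 0 := by linarith
  obtain ⟨B, hB, hcut⟩ := hT.exists_eLpNorm_cutOrbit_le hc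
  refine ⟨B, hB, fun k C m hk hm x => ⟨?_, ?_⟩⟩
  · exact (decayCalc T k).continuous.comp_aestronglyMeasurable (hT.aestronglyMeasurable x)
  have hm0 : 0 ≤ m := (norm_nonneg _).trans (hm (-1) (by simp))
  obtain ⟨hF2, hFn⟩ := (hcut x).1.memLp_fourier (hT.integrable_cutOrbit hc x)
  have hle : ∀ ξ, ‖k (vline (-(ω / 2)) ξ) • 𝓕 (cutOrbit T (-(ω / 2)) x) ξ‖ ≤
      m * ‖𝓕 (cutOrbit T (-(ω / 2)) x) ξ‖ := fun ξ => by
    rw [norm_smul]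
    exact mul_le_mul_of_nonneg_right (hm _ (by simpa using hω)) (norm_nonneg _)
  have hi := hT.integrable_vline_smul hk hc hc0 x
  have h2 : MemLp (fun ξ => k (vline (-(ω / 2)) ξ) • 𝓕 (cutOrbit T (-(ω / 2)) x) ξ) 2 :=
    hF2.of_le_mul hi.1 (Eventually.of_forall hle)
  calc eLpNorm (fun t => decayCalc T k (T t x)) 2 (volume.restrict (Set.Ioi 0))
      ≤ eLpNorm (𝓕⁻ fun ξ => k (vline (-(ω / 2)) ξ) • 𝓕 (cutOrbit T (-(ω / 2)) x) ξ) 2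
          (volume.restrict (Set.Ioi 0)) := by
        refine eLpNorm_mono_ae ?_
        filter_upwards [ae_restrict_mem measurableSet_Ioi] with t ht
        rw [hT.decayCalc_orbit hk hc hc0 (le_of_lt ht), norm_smul, Complex.norm_exp]
        refine mul_le_of_le_one_left (norm_nonneg _) (Real.exp_le_one_iff.2 ?_)
        have : (0 : ℝ) < t := ht
        simp; positivity
    _ ≤ eLpNorm (𝓕⁻ fun ξ => k (vline (-(ω / 2)) ξ) • 𝓕 (cutOrbit T (-(ω / 2)) x) ξ) 2 volume :=
        eLpNorm_mono_measure _ Measure.restrict_le_self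
    _ = eLpNorm (fun ξ => k (vline (-(ω / 2)) ξ) • 𝓕 (cutOrbit T (-(ω / 2)) x) ξ) 2 volume :=
        (h2.memLp_fourierInv hi).2
    _ ≤ ENNReal.ofReal m * eLpNorm (𝓕 (cutOrbit T (-(ω / 2)) x)) 2 volume :=
        eLpNorm_le_mul_eLpNorm_of_ae_le_mul (Eventually.of_forall hle) 2
    _ ≤ ENNReal.ofReal m * ENNReal.ofReal (B * ‖x‖) := by
        rw [hFn]; gcongr; exact (hcut x).2
    _ = ENNReal.ofReal (B * m * ‖x‖) := by
        rw [← ENNReal.ofReal_mul hm0]; ring_nf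

/-- For `0 < s ≤ t`, commutation gives `K T(t)x = T(t-s) K T(s)x`, so `‖K T(t)x‖ ≤ M ‖K T(s)x‖`. The
`L²` norm of this in `s` over `(0,t]` is `√t ‖K T(t)x‖ ≤ M b`. -/
theorem norm_orbit_le_of_eLpNorm_le (hT : IsStableSemigroup T M ω) {K : X →L[ℂ] X}
    (hcomm : ∀ s : ℝ, 0 ≤ s → ∀ x, K (T s x) = T s (K x)) {x : X} {b : ℝ} (hb : 0 ≤ b)
    (hK : eLpNorm (fun t => K (T t x)) 2 (volume.restrict (Set.Ioi 0)) ≤ ENNReal.ofReal b)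
    {t : ℝ} (ht : 0 < t) : ‖K (T t x)‖ ≤ M * b / Real.sqrt t := by
  have h1 : eLpNorm (fun _ : ℝ => K (T t x)) 2 (volume.restrict (Set.Ioc 0 t)) ≤
      ENNReal.ofReal (M * b) := by
    calc eLpNorm (fun _ : ℝ => K (T t x)) 2 (volume.restrict (Set.Ioc 0 t))
        ≤ ENNReal.ofReal M *
          eLpNorm (fun s => K (T s x)) 2 (volume.restrict (Set.Ioc 0 t)) := by
          refine eLpNorm_le_mul_eLpNorm_of_ae_le_mul ?_ 2
          filter_upwards [ae_restrict_mem measurableSet_Ioc] with s hs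
          have hts : 0 ≤ t - s := sub_nonneg.2 hs.2
          rw [← sub_add_cancel t s, hT.apply_add hts hs.1.le, hcomm _ hts]
          exact (T (t - s)).le_of_opNorm_le (hT.norm_le_const hts) _
      _ ≤ ENNReal.ofReal M * ENNReal.ofReal b := by
          gcongr
          exact (eLpNorm_mono_measure _
            (Measure.restrict_mono Set.Ioc_subset_Ioi_self le_rfl)).trans hK
      _ = ENNReal.ofReal (M * b) := (ENNReal.ofReal_mul hT.nonneg).symm
  have hμ : (volume.restrict (Set.Ioc 0 t)) ≠ 0 := by
    rw [Ne, Measure.restrict_eq_zero]; simpa using ht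
  rw [eLpNorm_const _ two_ne_zero hμ] at h1
  rw [Measure.restrict_apply_univ, Real.volume_Ioc, sub_zero, ← ofReal_norm,
    ENNReal.ofReal_rpow_of_pos ht, ← ENNReal.ofReal_mul (norm_nonneg _),
    ENNReal.ofReal_le_ofReal_iff (mul_nonneg hT.nonneg hb)] at h1
  rw [le_div_iff₀ (Real.sqrt_pos.2 ht), Real.sqrt_eq_rpow]
  simpa using h1

/-- The singularity `t^{-1/2}` is integrable at zero, and `∫₀^∞ e^{-t} t^{-1/2} dt = Γ(1/2)`. -/
theorem norm_semOp_exp_le [CompleteSpace X] (hT : IsStableSemigroup T M ω) {K : X →L[ℂ] X}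
    {x : X} {b : ℝ}
    (hK : ∀ t : ℝ, 0 < t → ‖K (T t x)‖ ≤ b / Real.sqrt t) :
    ‖K (laplaceResolvent T 1 x)‖ ≤ b * Real.Gamma (1 / 2) := by
  have hw : WeightedIntegrable ω fun t => Complex.exp (-(1 : ℂ) * t) :=
    weightedIntegrable_cexp (by simpa using by linarith [hT.pos])
  rw [laplaceResolvent, hT.semOp_apply hw,
    ← ContinuousLinearMap.integral_comp_comm _ (hT.integrableOn_smul hw x),
    Real.Gamma_eq_integral (by norm_num), ← integral_const_mul]
  refine norm_integral_le_of_norm_le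
    ((Real.GammaIntegral_convergent (by norm_num : (0 : ℝ) < 1 / 2)).const_mul b) ?_
  filter_upwards [ae_restrict_mem measurableSet_Ioi] with t ht
  have ht0 : (0 : ℝ) < t := ht
  rw [map_smul, norm_smul, Complex.norm_exp]
  have hre : (-(1 : ℂ) * t).re = -t := by simp
  have hpow : t ^ ((1 : ℝ) / 2 - 1) = (Real.sqrt t)⁻¹ := by
    rw [Real.sqrt_eq_rpow, ← Real.rpow_neg ht0.le]; norm_num
  rw [hre, hpow]
  calc Real.exp (-t) * ‖K (T t x)‖ ≤ Real.exp (-t) * (b / Real.sqrt t) := by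
        gcongr; exact hK t ht
    _ = _ := by ring

end IsStableSemigroup

end Bounds

/-! ### Approximation of bounded holomorphic functions by decaying ones. -/

section Approximation

/-- The function `s ↦ (n+1)/(n+1-s)`. -/
noncomputable def yosidaFactor (n : ℕ) (s : ℂ) : ℂ := ((n : ℂ) + 1) * ((n : ℂ) + 1 - s)⁻¹

/-- The approximants `(n+1)²/(n+1-s)² g(s)` of `g`. -/
noncomputable def yosidaApprox (g : ℂ → ℂ) (n : ℕ) (s : ℂ) : ℂ :=
  yosidaFactor n s * yosidaFactor n s * g s

/-- The function `(1-s)⁻² g(s)`. -/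
noncomputable def regularize (g : ℂ → ℂ) (s : ℂ) : ℂ := (1 - s)⁻¹ * ((1 - s)⁻¹ * g s)

/-- `g` is holomorphic on the left half-plane and bounded there by `m`. -/
structure IsBoundedHolo (g : ℂ → ℂ) (m : ℝ) : Prop where
  differentiableOn : DifferentiableOn ℂ g leftHalfPlane
  norm_le : ∀ s : ℂ, s.re < 0 → ‖g s‖ ≤ m

theorem differentiableOn_inv_sub {a : ℂ} (ha : 0 < a.re) :
    DifferentiableOn ℂ (fun s => (a - s)⁻¹) leftHalfPlane := by
  refine DifferentiableOn.inv (by fun_prop) fun s hs h => ?_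
  have hs' : s.re < 0 := hs
  rw [sub_eq_zero] at h
  rw [h] at ha
  linarith

theorem norm_inv_sub_le {a s : ℂ} (ha : 0 < a.re) (hs : s.re ≤ 0) : ‖(a - s)⁻¹‖ ≤ a.re⁻¹ := by
  rw [norm_inv]
  refine inv_anti₀ ha ((Complex.re_le_norm _).trans' ?_)
  simpa using hs

theorem isBoundedHolo_inv_sub {a : ℂ} (ha : 0 < a.re) :
    IsBoundedHolo (fun s => (a - s)⁻¹) a.re⁻¹ :=
  ⟨differentiableOn_inv_sub ha, fun _ hs => norm_inv_sub_le ha hs.le⟩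

theorem norm_inv_sub_sq_le {r : ℝ} (hr : 1 ≤ r) {s : ℂ} (hs : s.re < 0) :
    ‖((r : ℂ) - s)⁻¹‖ * ‖((r : ℂ) - s)⁻¹‖ ≤ (1 + s.im ^ 2)⁻¹ := by
  rw [norm_inv, ← mul_inv, Complex.norm_mul_self_eq_normSq, Complex.normSq_apply]
  refine inv_anti₀ (by positivity) ?_
  simp only [Complex.sub_re, Complex.ofReal_re, Complex.sub_im, Complex.ofReal_im, zero_sub]
  nlinarith

theorem norm_yosidaFactor_le (n : ℕ) {s : ℂ} (hs : s.re ≤ 0) : ‖yosidaFactor n s‖ ≤ 1 := by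
  have hpos : (0 : ℝ) < n + 1 := by positivity
  have h := norm_inv_sub_le (a := (n : ℂ) + 1) (s := s) (by simpa using hpos) hs
  have hn : ‖(n : ℂ) + 1‖ = (n : ℝ) + 1 := by
    rw [← Complex.ofReal_natCast, ← Complex.ofReal_one, ← Complex.ofReal_add, Complex.norm_real,
      Real.norm_of_nonneg hpos.le]
  rw [yosidaFactor, norm_mul, hn]
  simp only [Complex.add_re, Complex.natCast_re, Complex.one_re] at h
  calc ((n : ℝ) + 1) * ‖((n : ℂ) + 1 - s)⁻¹‖ ≤ ((n : ℝ) + 1) * ((n : ℝ) + 1)⁻¹ := by gcongr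
    _ = 1 := mul_inv_cancel₀ hpos.ne'

theorem tendsto_yosidaFactor (s : ℂ) : Tendsto (fun n => yosidaFactor n s) atTop (𝓝 1) := by
  have h1 : Tendsto (fun n : ℕ => (1 - s * ((n : ℂ) + 1)⁻¹)⁻¹) atTop (𝓝 (1 - s * 0)⁻¹) := by
    have h2 : Tendsto (fun n : ℕ => ((n : ℂ) + 1)⁻¹) atTop (𝓝 0) := by
      have := tendsto_one_div_add_atTop_nhds_zero_nat (𝕜 := ℂ)
      simpa using this
    exact ((h2.const_mul s).const_sub 1).inv₀ (by simp)
  simp only [mul_zero, sub_zero, inv_one] at h1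
  refine h1.congr fun n => ?_
  have hn : (n : ℂ) + 1 ≠ 0 := Nat.cast_add_one_ne_zero n
  rw [yosidaFactor]
  rw [show (1 - s * ((n : ℂ) + 1)⁻¹) = ((n : ℂ) + 1)⁻¹ * ((n : ℂ) + 1 - s) by field_simp,
    mul_inv, inv_inv]

theorem differentiableOn_yosidaFactor (n : ℕ) :
    DifferentiableOn ℂ (yosidaFactor n) leftHalfPlane :=
  (differentiableOn_inv_sub (a := (n : ℂ) + 1) (by simpa using by positivity)).const_mul _

namespace IsBoundedHolo

variable {g g₁ g₂ : ℂ → ℂ} {m m₁ m₂ : ℝ}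

theorem nonneg (hg : IsBoundedHolo g m) : 0 ≤ m :=
  (norm_nonneg _).trans (hg.norm_le (-1) (by simp))

theorem mul (h₁ : IsBoundedHolo g₁ m₁) (h₂ : IsBoundedHolo g₂ m₂) :
    IsBoundedHolo (fun s => g₁ s * g₂ s) (m₁ * m₂) :=
  ⟨h₁.differentiableOn.mul h₂.differentiableOn, fun s hs => by
    rw [norm_mul]
    exact mul_le_mul (h₁.norm_le s hs) (h₂.norm_le s hs) (norm_nonneg _) h₁.nonneg⟩

theorem isDecaying_regularize (hg : IsBoundedHolo g m) : IsDecaying (regularize g) m where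
  differentiableOn := by
    have := differentiableOn_inv_sub (a := 1) (by simp)
    exact this.mul (this.mul hg.differentiableOn)
  norm_le s hs := by
    have := norm_inv_sub_sq_le le_rfl hs
    rw [regularize, norm_mul, norm_mul, ← mul_assoc, mul_comm m]
    rw [Complex.ofReal_one] at this
    exact mul_le_mul this (hg.norm_le s hs) (norm_nonneg _) (by positivity)

theorem yosidaApprox (hg : IsBoundedHolo g m) (n : ℕ) : IsBoundedHolo (yosidaApprox g n) m where
  differentiableOn := ((differentiableOn_yosidaFactor n).mul
    (differentiableOn_yosidaFactor n)).mul hg.differentiableOn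
  norm_le s hs := by
    have h := norm_yosidaFactor_le n hs.le
    rw [_root_.yosidaApprox, norm_mul, norm_mul, ← one_mul m]
    exact mul_le_mul (mul_le_one₀ h (norm_nonneg _) h) (hg.norm_le s hs) (norm_nonneg _) zero_le_one

theorem isDecaying_yosidaApprox (hg : IsBoundedHolo g m) (n : ℕ) :
    IsDecaying (_root_.yosidaApprox g n) (((n : ℝ) + 1) ^ 2 * m) where
  differentiableOn := (hg.yosidaApprox n).differentiableOn
  norm_le s hs := by
    have h := norm_inv_sub_sq_le (r := (n : ℝ) + 1) (by simp) hs
    have hn : ‖(n : ℂ) + 1‖ = (n : ℝ) + 1 := by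
      rw [← Complex.ofReal_natCast, ← Complex.ofReal_one, ← Complex.ofReal_add, Complex.norm_real,
        Real.norm_of_nonneg (by positivity)]
    push_cast at h
    rw [_root_.yosidaApprox, yosidaFactor, norm_mul, norm_mul, norm_mul, hn]
    calc _ = ((n : ℝ) + 1) ^ 2 * (‖((n : ℂ) + 1 - s)⁻¹‖ * ‖((n : ℂ) + 1 - s)⁻¹‖) * ‖g s‖ := by ring
      _ ≤ ((n : ℝ) + 1) ^ 2 * (1 + s.im ^ 2)⁻¹ * m := by
          gcongr
          · exact hg.norm_le s hs
      _ = _ := by ring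

end IsBoundedHolo

theorem IsDecaying.yosidaApprox {k : ℂ → ℂ} {C : ℝ} (hk : IsDecaying k C) (n : ℕ) :
    IsDecaying (yosidaApprox k n) C where
  differentiableOn := ((differentiableOn_yosidaFactor n).mul
    (differentiableOn_yosidaFactor n)).mul hk.differentiableOn
  norm_le s hs := by
    have h := norm_yosidaFactor_le n hs.le
    rw [_root_.yosidaApprox, norm_mul, norm_mul, ← one_mul (C * _)]
    exact mul_le_mul (mul_le_one₀ h (norm_nonneg _) h) (hk.norm_le s hs) (norm_nonneg _) zero_le_one

theorem tendsto_yosidaApprox (g : ℂ → ℂ) (s : ℂ) :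
    Tendsto (fun n => yosidaApprox g n s) atTop (𝓝 (g s)) := by
  have := ((tendsto_yosidaFactor s).mul (tendsto_yosidaFactor s)).mul_const (g s)
  simpa [yosidaApprox] using this

end Approximation

/-! ### The Laplace transform of the semigroup is the resolvent of the generator; density of its
range. -/

section Resolvent

namespace IsStableSemigroup

variable {X : Type*} [NormedAddCommGroup X] [NormedSpace ℂ X]
  {T : ℝ → X →L[ℂ] X} {M ω : ℝ} {A : X →ₗ.[ℂ] X} {a : ℂ}

theorem laplaceResolvent_apply (hT : IsStableSemigroup T M ω) (ha : 0 < a.re) (x : X) :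
    laplaceResolvent T a x = ∫ t in Set.Ioi (0 : ℝ), Complex.exp (-a * t) • T t x :=
  hT.semOp_apply (weightedIntegrable_cexp (by linarith [hT.pos])) x

theorem tendsto_laplaceResolvent_quotient [CompleteSpace X] (hT : IsStableSemigroup T M ω)
    (ha : 0 < a.re) (x : X) :
    Tendsto (fun h : ℝ => (h : ℂ)⁻¹ • (T h (laplaceResolvent T a x) - laplaceResolvent T a x))
      (𝓝[>] 0) (𝓝 (a • laplaceResolvent T a x - x)) := by
  have hw : WeightedIntegrable ω fun t => Complex.exp (-a * t) :=
    weightedIntegrable_cexp (by linarith [hT.pos])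
  set f : ℝ → X := fun t => Complex.exp (-a * t) • T t x with hf
  have hfi : IntegrableOn f (Set.Ioi 0) := hT.integrableOn_smul hw x
  have hfc : ContinuousOn f (Set.Ici 0) :=
    ContinuousOn.smul (by fun_prop) (hT.continuousOn x)
  have hR := hT.laplaceResolvent_apply ha x
  set R := laplaceResolvent T a x
  -- By shifting the Laplace integral, `F h = T h R` for `h > 0`. The difference quotient of the
  -- semigroup at `R` is thus a slope of `F` at zero, and `F` is differentiated by the fundamental
  -- theorem of calculus.
  let F : ℝ → X := fun h => Complex.exp (a * h) • (R - ∫ t in (0 : ℝ)..h, f t)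
  have hF : HasDerivWithinAt F (a • R - x) (Set.Ici 0) 0 := by
    have h1 : HasDerivWithinAt (fun h : ℝ => ∫ t in (0 : ℝ)..h, f t) (f 0) (Set.Ici 0) 0 := by
      refine intervalIntegral.integral_hasDerivWithinAt_right (by simp)
        (s := Set.Ici 0) (t := Set.Ioi 0) ?_ ?_
      · exact ⟨Set.Ioi 0, self_mem_nhdsWithin, hfi.1⟩
      · exact (hfc 0 Set.self_mem_Ici).mono Set.Ioi_subset_Ici_self
    have h2 : HasDerivAt (fun h : ℝ => Complex.exp (a * h)) a 0 := by
      have := (((Complex.ofRealCLM.hasDerivAt (x := 0)).const_mul a)).cexp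
      simpa using this
    have h3 := h2.hasDerivWithinAt.smul (h1.const_sub R) (s := Set.Ici 0)
    have h0 : f 0 = x := by simp [hf, hT.map_zero]
    simp only [h0] at h3
    have h4 : Complex.exp (a * (0 : ℝ)) • -x + a • (R - ∫ t in (0 : ℝ)..0, f t) = a • R - x := by
      simp [sub_eq_neg_add]
    rw [h4] at h3
    exact h3
  have hFT : ∀ h : ℝ, 0 < h → F h = T h R := by
    intro h hh
    have hsplit : R - ∫ t in (0 : ℝ)..h, f t = ∫ t in Set.Ioi h, f t := by
      rw [hR, sub_eq_iff_eq_add, add_comm]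
      exact (intervalIntegral.integral_interval_add_Ioi hfi
        (hfi.mono_set (Set.Ioi_subset_Ioi hh.le))).symm
    have hshift := (measurePreserving_add_right (volume : Measure ℝ) h).setIntegral_preimage_emb
      (measurableEmbedding_addRight h) f (Set.Ioi h)
    rw [Set.preimage_add_const_Ioi, sub_self] at hshift
    simp only [F]
    rw [hsplit, ← hshift, hR, ← ContinuousLinearMap.integral_comp_comm _ hfi, ← integral_smul]
    refine setIntegral_congr_fun measurableSet_Ioi fun t ht => ?_
    simp only [hf, map_smul]
    rw [smul_smul, ← Complex.exp_add, ← hT.apply_add hh.le (le_of_lt ht), add_comm h t]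
    congr 2
    push_cast; ring
  have hslope := hasDerivWithinAt_iff_tendsto_slope.1 hF
  rw [Set.Ici_sdiff_left] at hslope
  refine hslope.congr' ?_
  filter_upwards [self_mem_nhdsWithin] with h hh
  have hF0 : F 0 = R := by simp [F]
  rw [slope_def_module, hF0, hFT h hh, sub_zero, ← Complex.ofReal_inv, Complex.coe_smul]

theorem isResolventAt [CompleteSpace X] (hT : IsStableSemigroup T M ω) (hA : IsGenerator A T)
    (ha : 0 < a.re) :
    IsResolventAt A a (laplaceResolvent T a) := by
  have hgraph : ∀ x, (laplaceResolvent T a x, a • laplaceResolvent T a x - x) ∈ A.graph :=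
    fun x => (hA _ _).2 (hT.tendsto_laplaceResolvent_quotient ha x)
  refine ⟨fun x => ?_, fun y => ?_⟩
  · obtain ⟨z, hz1, hz2⟩ := (LinearPMap.mem_graph_iff A).1 (hgraph x)
    simp only at hz1 hz2
    refine ⟨hz1 ▸ z.2, ?_⟩
    have : (⟨laplaceResolvent T a x, hz1 ▸ z.2⟩ : A.domain) = z := Subtype.ext hz1.symm
    rw [this, hz2]
    abel
  · have h1 := (hA y (A y)).1 (A.mem_graph y)
    have h2 := ((laplaceResolvent T a).continuous.tendsto _).comp h1
    have h3 := hT.tendsto_laplaceResolvent_quotient ha (y : X)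
    have heq : laplaceResolvent T a (A y) = a • laplaceResolvent T a y - y := by
      refine tendsto_nhds_unique (h2.congr' ?_) h3
      filter_upwards [self_mem_nhdsWithin] with h hh
      have hc : laplaceResolvent T a (T h y) = T h (laplaceResolvent T a y) :=
        hT.semOp_comm (weightedIntegrable_cexp (by linarith [hT.pos])) (le_of_lt hh) _
      simp only [Function.comp_apply, map_smul, map_sub]
      rw [hc]
    rw [map_sub, map_smul, heq]
    abel

/-- After the substitution `u = (n+1)t` the vector is the average of `T(u/(n+1))x` against the
probability density `e^{-u}`, and strong continuity at zero applies. -/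
theorem tendsto_smul_laplaceResolvent [CompleteSpace X] (hT : IsStableSemigroup T M ω) (x : X) :
    Tendsto (fun n : ℕ => ((n : ℂ) + 1) • laplaceResolvent T ((n : ℂ) + 1) x) atTop (𝓝 x) := by
  have hint : ∀ n : ℕ, ((n : ℂ) + 1) • laplaceResolvent T ((n : ℂ) + 1) x =
      ∫ u in Set.Ioi (0 : ℝ), Real.exp (-u) • T (u / ((n : ℝ) + 1)) x := fun n => by
    have hn : (0 : ℝ) < (n : ℝ) + 1 := by positivity
    have h1 := integral_comp_mul_left_Ioi
      (fun u : ℝ => Real.exp (-u) • T (u / ((n : ℝ) + 1)) x) 0 hn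
    rw [mul_zero] at h1
    rw [hT.laplaceResolvent_apply (by simpa using hn)]
    have h2 : ∫ t in Set.Ioi (0 : ℝ), Complex.exp (-((n : ℂ) + 1) * t) • T t x =
        ((n : ℝ) + 1)⁻¹ • ∫ u in Set.Ioi (0 : ℝ), Real.exp (-u) • T (u / ((n : ℝ) + 1)) x := by
      rw [← h1]
      congr 1
      funext t
      rw [mul_div_cancel_left₀ _ hn.ne', ← Complex.coe_smul]
      push_cast
      ring_nf
    rw [h2, ← Complex.coe_smul, smul_smul]
    push_cast
    rw [mul_inv_cancel₀ (Nat.cast_add_one_ne_zero n), one_smul]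
  simp_rw [hint]
  have hx : x = ∫ u in Set.Ioi (0 : ℝ), Real.exp (-u) • x := by
    rw [integral_smul_const, integral_exp_neg_Ioi]
    simp
  conv => arg 3; rw [hx]
  refine tendsto_integral_of_dominated_convergence (fun u => Real.exp (-u) * (M * ‖x‖)) ?_ ?_ ?_ ?_
  · intro n
    have hc : ContinuousOn (fun u : ℝ => Real.exp (-u) • T (u / ((n : ℝ) + 1)) x) (Set.Ioi 0) := by
      have h1 : ContinuousOn (fun u : ℝ => Real.exp (-u)) (Set.Ioi 0) := by fun_prop
      refine h1.smul ((hT.continuousOn x).comp (by fun_prop) fun u hu => ?_)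
      have hu' : (0 : ℝ) < u := hu
      exact div_nonneg hu'.le (by positivity)
    exact hc.aestronglyMeasurable measurableSet_Ioi
  · have := (exp_neg_integrableOn_Ioi 0 one_pos).mul_const (M * ‖x‖)
    simpa using this
  · intro n
    filter_upwards [ae_restrict_mem measurableSet_Ioi] with u hu
    have hu' : (0 : ℝ) < u := hu
    rw [norm_smul, Real.norm_of_nonneg (Real.exp_nonneg _)]
    gcongr
    exact (T _).le_of_opNorm_le (hT.norm_le_const (div_nonneg hu'.le (by positivity))) x
  · filter_upwards [ae_restrict_mem measurableSet_Ioi] with u hu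
    have hu' : (0 : ℝ) < u := hu
    have h1 : Tendsto (fun n : ℕ => u / ((n : ℝ) + 1)) atTop (𝓝[Set.Ici 0] 0) := by
      refine tendsto_nhdsWithin_iff.2 ⟨?_, Eventually.of_forall fun n =>
        div_nonneg hu'.le (by positivity)⟩
      have := (tendsto_one_div_add_atTop_nhds_zero_nat (𝕜 := ℝ)).const_mul u
      simpa [div_eq_mul_inv] using this
    have h2 := ((hT.continuousOn x 0 Set.self_mem_Ici).tendsto.comp h1).const_smul (Real.exp (-u))
    simpa [hT.map_zero] using h2

theorem denseRange_laplaceResolvent [CompleteSpace X] (hT : IsStableSemigroup T M ω)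
    (hA : IsGenerator A T) :
    DenseRange (laplaceResolvent T 1) := by
  intro x
  refine mem_closure_of_tendsto (hT.tendsto_smul_laplaceResolvent x)
    (Eventually.of_forall fun n => ?_)
  have hn : 0 < ((n : ℂ) + 1).re := by simpa using by positivity
  obtain ⟨h, -⟩ := (hT.isResolventAt hA hn).1 x
  -- The approximating vector lies in `D(A)`, so it is the image under `(1 - A)⁻¹` of `1 - A`
  -- applied to it.
  refine ⟨((n : ℂ) + 1) • ((1 : ℂ) • laplaceResolvent T ((n : ℂ) + 1) x - A ⟨_, h⟩), ?_⟩
  rw [map_smul, (hT.isResolventAt hA (a := 1) (by simp)).2 ⟨_, h⟩]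

end IsStableSemigroup

end Resolvent

/-! ### Boundary values and the Toeplitz operator. -/

section Toeplitz

/-- Dominated convergence in `L²`. -/
theorem tendsto_eLpNorm_two_of_dominated {α E : Type*} [MeasurableSpace α] {μ : Measure α}
    [NormedAddCommGroup E] {f : ℕ → α → E} {f₀ : α → E} {b : α → ℝ} (hb : MemLp b 2 μ)
    (hf : ∀ n, AEStronglyMeasurable (f n) μ) (hf₀ : AEStronglyMeasurable f₀ μ)
    (hle : ∀ n, ∀ᵐ a ∂μ, ‖f n a - f₀ a‖ ≤ b a)
    (hlim : ∀ᵐ a ∂μ, Tendsto (fun n => f n a) atTop (𝓝 (f₀ a))) :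
    Tendsto (fun n => eLpNorm (f n - f₀) 2 μ) atTop (𝓝 0) := by
  have h1 : Tendsto (fun n => ∫⁻ a, ‖f n a - f₀ a‖ₑ ^ (2 : ℝ) ∂μ) atTop
      (𝓝 (∫⁻ _, 0 ∂μ)) := by
    refine tendsto_lintegral_of_dominated_convergence' (fun a => ‖b a‖ₑ ^ (2 : ℝ))
      (fun n => ((hf n).sub hf₀).enorm.pow_const _) (fun n => ?_) ?_ ?_
    · filter_upwards [hle n] with a ha
      gcongr
      rw [← ofReal_norm, ← ofReal_norm]
      exact ENNReal.ofReal_le_ofReal (ha.trans (le_abs_self _))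
    · have := hb.2
      rw [eLpNorm_eq_lintegral_rpow_enorm_toReal two_ne_zero ENNReal.ofNat_ne_top] at this
      simp only [ENNReal.toReal_ofNat] at this
      exact ((ENNReal.rpow_lt_top_iff_of_pos (by norm_num)).1 this).ne
    · filter_upwards [hlim] with a ha
      have h2 : Tendsto (fun n => ‖f n a - f₀ a‖ₑ) atTop (𝓝 0) := by
        have := (ha.sub_const (f₀ a)).enorm
        simpa using this
      have h3 := h2.ennrpow_const (2 : ℝ)
      simpa using h3
  have h4 := h1.ennrpow_const (1 / 2 : ℝ)
  simp only [lintegral_zero] at h4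
  rw [ENNReal.zero_rpow_of_pos (by norm_num)] at h4
  refine h4.congr fun n => ?_
  rw [eLpNorm_eq_lintegral_rpow_enorm_toReal two_ne_zero ENNReal.ofNat_ne_top]
  simp

namespace IsStableSemigroup

variable {X : Type*} [NormedAddCommGroup X] [NormedSpace ℂ X] {T : ℝ → X →L[ℂ] X} {M ω : ℝ}

theorem tendsto_fourier_cutOrbit (hT : IsStableSemigroup T M ω) {c : ℕ → ℝ}
    (hc : Tendsto c atTop (𝓝 0)) (x : X) (ξ : ℝ) :
    Tendsto (fun j => 𝓕 (cutOrbit T (c j) x) ξ) atTop (𝓝 (𝓕 (cutOrbit T 0 x) ξ)) := by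
  have hω := hT.pos
  simp_rw [fourier_cutOrbit, orbitLaplace]
  refine tendsto_integral_filter_of_dominated_convergence
    (fun t => Real.exp (-(ω / 2) * t) * (M * ‖x‖)) ?_ ?_ ?_ ?_
  · refine Eventually.of_forall fun j => AEStronglyMeasurable.smul ?_ (hT.aestronglyMeasurable x)
    apply Continuous.aestronglyMeasurable; fun_prop
  · filter_upwards [hc.eventually (lt_mem_nhds (by linarith : -(ω / 2) < 0))] with j hj
    filter_upwards [ae_restrict_mem measurableSet_Ioi] with t ht
    have ht' : (0 : ℝ) < t := ht
    rw [norm_smul, Complex.norm_exp]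
    calc _ ≤ Real.exp (-(c j) * t) * (M * Real.exp (-ω * t) * ‖x‖) := by
          refine mul_le_mul (le_of_eq ?_) (hT.norm_apply_le ht'.le x) (norm_nonneg _)
            (Real.exp_nonneg _)
          simp
      _ = Real.exp (-(c j) * t + -ω * t) * (M * ‖x‖) := by rw [Real.exp_add]; ring
      _ ≤ Real.exp (-(ω / 2) * t) * (M * ‖x‖) := by
          refine mul_le_mul_of_nonneg_right (Real.exp_le_exp.2 (by nlinarith))
            (mul_nonneg hT.nonneg (norm_nonneg _))
  · exact (exp_neg_integrableOn_Ioi 0 (half_pos hω)).mul_const _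
  · refine Eventually.of_forall fun t => Tendsto.smul_const ?_ _
    have h1 : Continuous fun r : ℝ =>
        Complex.exp (-((r : ℂ) + 2 * Real.pi * ξ * Complex.I) * t) := by fun_prop
    exact (h1.tendsto 0).comp hc

/-- The limit `c ↑ 0` of the orbit formula. Once `c > -ω/2`, the quadratic decay of `k` and the
bound `M (ω/2)⁻¹ ‖x‖` on the transformed orbit dominate the integrand. -/
theorem decayCalc_orbit_boundary [CompleteSpace X] (hT : IsStableSemigroup T M ω) {k : ℂ → ℂ}
    {C : ℝ} (hk : IsDecaying k C) {β : ℝ → ℂ} {c : ℕ → ℝ} (hc : Tendsto c atTop (𝓝 0))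
    (hc0 : ∀ j, c j < 0)
    (hβ : ∀ᵐ ξ : ℝ, Tendsto (fun j => k (vline (c j) ξ)) atTop (𝓝 (β ξ)))
    {t : ℝ} (ht : 0 ≤ t) (x : X) :
    decayCalc T k (T t x) = 𝓕⁻ (fun ξ => β ξ • 𝓕 (cutOrbit T 0 x) ξ) t := by
  have hω := hT.pos
  have hev : ∀ᶠ j in atTop, -(ω / 2) < c j :=
    hc.eventually (lt_mem_nhds (by linarith : -(ω / 2) < 0))
  have hmain : Tendsto (fun j => Complex.exp (c j * t) •
      𝓕⁻ (fun ξ => k (vline (c j) ξ) • 𝓕 (cutOrbit T (c j) x) ξ) t) atTop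
      (𝓝 (Complex.exp ((0 : ℝ) * t) • 𝓕⁻ (fun ξ => β ξ • 𝓕 (cutOrbit T 0 x) ξ) t)) := by
    refine Tendsto.smul ?_ ?_
    · have h1 : Continuous fun r : ℝ => Complex.exp ((r : ℂ) * t) := by fun_prop
      exact (h1.tendsto 0).comp hc
    · simp_rw [Real.fourierInv_eq']
      refine tendsto_integral_filter_of_dominated_convergence
        (fun ξ => C * (1 + (2 * Real.pi * ξ) ^ 2)⁻¹ * (M * (ω / 2)⁻¹ * ‖x‖)) ?_ ?_
        ((integrable_lineWeight.const_mul C).mul_const _) ?_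
      · filter_upwards [hev] with j hj
        refine AEStronglyMeasurable.smul ?_
          (hT.integrable_vline_smul hk (by linarith) (hc0 j) x).1
        apply Continuous.aestronglyMeasurable; fun_prop
      · filter_upwards [hev] with j hj
        refine Eventually.of_forall fun ξ => ?_
        rw [norm_smul, Complex.norm_exp_ofReal_mul_I, one_mul, norm_smul]
        refine mul_le_mul (hk.norm_vline_le (hc0 j) ξ)
          ((hT.norm_fourier_cutOrbit_le (by linarith) x ξ).trans ?_)
          (norm_nonneg _) (mul_nonneg hk.const_nonneg (by positivity))
        have := hT.nonneg
        gcongr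
        linarith
      · filter_upwards [hβ] with ξ hξ
        exact (hξ.smul (hT.tendsto_fourier_cutOrbit hc x ξ)).const_smul _
  have hlim : Tendsto (fun j => Complex.exp (c j * t) •
      𝓕⁻ (fun ξ => k (vline (c j) ξ) • 𝓕 (cutOrbit T (c j) x) ξ) t) atTop
      (𝓝 (decayCalc T k (T t x))) := by
    refine tendsto_const_nhds.congr' ?_
    filter_upwards [hev] with j hj
    exact hT.decayCalc_orbit hk (by linarith) (hc0 j) ht x
  simpa using tendsto_nhds_unique hlim hmain

end IsStableSemigroup

/-- Limits of the approximants `(n+1)²/(n+1-s)² g(s)` of `g` applied to the semigroup realize the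
Toeplitz operator with symbol `g`. -/
theorem IsStableSemigroup.isToeplitzImage {X : Type*} [NormedAddCommGroup X]
    [InnerProductSpace ℂ X] [CompleteSpace X] {T : ℝ → X →L[ℂ] X} {M ω : ℝ}
    (hT : IsStableSemigroup T M ω) {g : ℂ → ℂ} {m : ℝ} (hg : IsBoundedHolo g m)
    {b : ℝ → ℂ} (hb : ∀ᵐ w : ℝ, Tendsto (fun j : ℕ => g (-(1 / ((j : ℝ) + 1) : ℝ) + w * Complex.I))
      atTop (𝓝 (b w)))
    {x : X} {u : ℝ → X} (hu : ∀ t : ℝ, 0 < t →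
      Tendsto (fun n => decayCalc T (yosidaApprox g n) (T t x)) atTop (𝓝 (u t))) :
    IsToeplitzImage b (fun t => T t x) u := by
  have hω := hT.pos
  obtain ⟨_, -, hcut⟩ := hT.exists_eLpNorm_cutOrbit_le (c := 0) (by linarith)
  have hF2 := (hcut x).1
  have hF1 := hT.integrable_cutOrbit (c := 0) (by linarith) x
  have hFF := (hF2.memLp_fourier hF1).1
  have hFc := hT.continuous_fourier_cutOrbit (c := 0) (by linarith) x
  let c : ℕ → ℝ := fun j => -(1 / ((j : ℝ) + 1))
  have hc0 : ∀ j, c j < 0 := fun j => by simp only [c]; rw [neg_lt_zero]; positivity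
  have hc : Tendsto c atTop (𝓝 0) := by
    have := (tendsto_one_div_add_atTop_nhds_zero_nat (𝕜 := ℝ)).neg
    rwa [neg_zero] at this
  let β : ℝ → ℂ := fun ξ => b (2 * Real.pi * ξ)
  have hβ : ∀ᵐ ξ : ℝ, Tendsto (fun j => g (vline (c j) ξ)) atTop (𝓝 (β ξ)) := by
    have hq : Measure.QuasiMeasurePreserving (fun ξ : ℝ => 2 * Real.pi * ξ) volume volume :=
      Measure.quasiMeasurePreserving_smul volume Real.two_pi_pos.ne'
    filter_upwards [hq.ae hb] with ξ hξ
    simpa [vline, c, β] using hξ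
  have hgc : ∀ j, Continuous fun ξ => g (vline (c j) ξ) := fun j =>
    hg.differentiableOn.continuousOn.comp_continuous (by fun_prop) fun ξ => by
      simpa [leftHalfPlane] using hc0 j
  have hβm : AEStronglyMeasurable β volume :=
    aestronglyMeasurable_of_tendsto_ae atTop (fun j => (hgc j).aestronglyMeasurable) hβ
  have hβn : ∀ᵐ ξ : ℝ, ‖β ξ‖ ≤ m := by
    filter_upwards [hβ] with ξ hξ
    exact le_of_tendsto hξ.norm (Eventually.of_forall fun j => hg.norm_le _ (by simpa using hc0 j))
  have hm := hg.nonneg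
  let p : ℕ → ℝ → ℂ := fun n ξ =>
    yosidaFactor n (vline 0 ξ) * yosidaFactor n (vline 0 ξ)
  have hpn : ∀ n ξ, ‖p n ξ‖ ≤ 1 := fun n ξ => by
    have h := norm_yosidaFactor_le n (s := vline 0 ξ) (by simp)
    rw [norm_mul]
    exact mul_le_one₀ h (norm_nonneg _) h
  have hyc : ∀ n, ∀ s : ℂ, s.re ≤ 0 → ContinuousAt (yosidaFactor n) s := fun n s hs => by
    refine continuousAt_const.mul (ContinuousAt.inv₀ (by fun_prop) fun h => ?_)
    have h' := congrArg Complex.re h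
    simp at h'
    have : (0 : ℝ) ≤ n := n.cast_nonneg
    linarith
  have hpc : ∀ n, Continuous (p n) := fun n => by
    have : Continuous fun ξ => yosidaFactor n (vline 0 ξ) := continuous_iff_continuousAt.2 fun ξ =>
      ContinuousAt.comp (f := vline 0) (hyc n _ (by simp)) (continuous_vline 0).continuousAt
    exact this.mul this
  have hkβ : ∀ n, ∀ᵐ ξ : ℝ, Tendsto (fun j => yosidaApprox g n (vline (c j) ξ)) atTop
      (𝓝 (p n ξ * β ξ)) := fun n => by
    filter_upwards [hβ] with ξ hξ
    have h1 : Tendsto (fun j => vline (c j) ξ) atTop (𝓝 (vline 0 ξ)) := by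
      have : Continuous fun r : ℝ => vline r ξ := by unfold vline; fun_prop
      exact (this.tendsto 0).comp hc
    have h2 := (hyc n (vline 0 ξ) (by simp)).tendsto.comp h1
    exact (h2.mul h2).mul hξ
  -- The quadratic decay of the approximants passes to their boundary values. It makes `hn n`
  -- integrable, so that its `L²` inverse transform is the integral in the orbit formula.
  have hbound : ∀ n, ∀ᵐ ξ : ℝ, ‖p n ξ * β ξ‖ ≤
      ((n : ℝ) + 1) ^ 2 * m * (1 + (2 * Real.pi * ξ) ^ 2)⁻¹ := fun n => by
    filter_upwards [hkβ n] with ξ hξ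
    exact le_of_tendsto hξ.norm (Eventually.of_forall fun j =>
      (hg.isDecaying_yosidaApprox n).norm_vline_le (hc0 j) ξ)
  let h : ℝ → X := fun ξ => β ξ • 𝓕 (cutOrbit T 0 x) ξ
  let hn : ℕ → ℝ → X := fun n ξ => (p n ξ * β ξ) • 𝓕 (cutOrbit T 0 x) ξ
  have hh2 : MemLp h 2 := by
    refine hFF.of_le_mul (hβm.smul hFF.1) (c := m) ?_
    filter_upwards [hβn] with ξ hξ
    rw [norm_smul]
    gcongr
  have hnm : ∀ n, AEStronglyMeasurable (hn n) volume := fun n =>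
    ((hpc n).aestronglyMeasurable.mul hβm).smul hFF.1
  have hn2 : ∀ n, MemLp (hn n) 2 := fun n => by
    refine hFF.of_le_mul (hnm n) (c := m) ?_
    filter_upwards [hβn] with ξ hξ
    rw [norm_smul, norm_mul, ← one_mul m]
    gcongr
    exact hpn n ξ
  have hn1 : ∀ n, Integrable (hn n) := fun n => by
    have hi : Integrable fun ξ => p n ξ * β ξ := (integrable_lineWeight.const_mul _).mono'
      ((hpc n).aestronglyMeasurable.mul hβm) (hbound n)
    exact hi.smul_bdd (M * (ω + 0)⁻¹ * ‖x‖) hFF.1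
      (Eventually.of_forall (hT.norm_fourier_cutOrbit_le (by linarith) x))
  have hconv : Tendsto (fun n => eLpNorm (hn n - h) 2 volume) atTop (𝓝 0) := by
    refine tendsto_eLpNorm_two_of_dominated
      (hFF.norm.const_mul (2 * m)) hnm hh2.1 (fun n => ?_) ?_
    · filter_upwards [hβn] with ξ hξ
      simp only [hn, h]
      rw [← sub_smul, norm_smul]
      gcongr
      refine (norm_sub_le _ _).trans ?_
      rw [norm_mul]
      nlinarith [mul_le_mul (hpn n ξ) hξ (norm_nonneg _) zero_le_one]
    · refine Eventually.of_forall fun ξ => ?_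
      have := (tendsto_yosidaFactor (vline 0 ξ)).mul (tendsto_yosidaFactor (vline 0 ξ))
      simpa [hn, h, p] using (this.mul_const (β ξ)).smul_const (𝓕 (cutOrbit T 0 x) ξ)
  have hLp : Tendsto (fun n => (hn2 n).toLp (hn n)) atTop (𝓝 (hh2.toLp h)) :=
    (Lp.tendsto_Lp_iff_tendsto_eLpNorm'' _ hn2 _ hh2).2 hconv
  have hG : Tendsto (fun n => (𝓕⁻ ((hn2 n).toLp (hn n)) : Lp X 2 (volume : Measure ℝ))) atTop
      (𝓝 (𝓕⁻ (hh2.toLp h))) :=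
    ((Lp.fourierTransformₗᵢ ℝ X).symm.continuous.tendsto _).comp hLp
  -- A subsequence of the inverse transforms converges almost everywhere. For `t > 0` these are the
  -- orbits that tend to `u t` pointwise, which identifies the `L²` limit with `u`.
  obtain ⟨ns, hns, hae⟩ := (tendstoInMeasure_of_tendsto_Lp hG).exists_seq_tendsto_ae
  refine ⟨hF2.toLp _, 𝓕⁻ (hh2.toLp h), ?_, ?_, ?_⟩
  · refine hF2.coeFn_toLp.trans (Eventually.of_forall fun t => ?_)
    simp [cutOrbit]
  · rw [FourierTransform.fourier_fourierInv_eq]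
    filter_upwards [hh2.coeFn_toLp, hF2.fourier_toLp_ae_eq hF1] with ξ h1 h2
    rw [h1, h2]
  · have hall : ∀ᵐ t : ℝ, ∀ n, (𝓕⁻ ((hn2 n).toLp (hn n)) : Lp X 2 (volume : Measure ℝ)) t =
        𝓕⁻ (hn n) t := ae_all_iff.2 fun n => (hn2 n).fourierInv_toLp_ae_eq (hn1 n)
    refine (ae_restrict_iff' measurableSet_Ioi).2 ?_
    filter_upwards [hae, hall] with t h1 h2 ht
    refine tendsto_nhds_unique h1 (((hu t ht).comp hns.tendsto_atTop).congr fun i => ?_)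
    rw [h2, Function.comp_apply, hT.decayCalc_orbit_boundary (hg.isDecaying_yosidaApprox _) hc hc0
      (hkβ _) (le_of_lt ht)]

end Toeplitz

/-! ### Strong limits of the approximants and their algebra. -/

section StrongLimits

/-- A bounded sequence of operators that converges on a dense set converges strongly. -/
theorem exists_strong_limit {X Y : Type*} [NormedAddCommGroup X] [NormedSpace ℂ X]
    [NormedAddCommGroup Y] [NormedSpace ℂ Y] [CompleteSpace Y] {L : ℕ → X →L[ℂ] Y} {C : ℝ}
    (hL : ∀ n x, ‖L n x‖ ≤ C * ‖x‖) (hC : 0 ≤ C) {ι : Type*} {P : ι → X} (hP : DenseRange P)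
    (hlim : ∀ i, ∃ z, Tendsto (fun n => L n (P i)) atTop (𝓝 z)) :
    ∃ L₀ : X →L[ℂ] Y, ‖L₀‖ ≤ C ∧ ∀ x, Tendsto (fun n => L n x) atTop (𝓝 (L₀ x)) := by
  have hcauchy : ∀ x, CauchySeq fun n => L n x := by
    intro x
    rw [Metric.cauchySeq_iff]
    intro ε hε
    -- The summand `1` covers the case `C = 0`.
    have hδ : 0 < ε / (3 * (C + 1)) := by positivity
    obtain ⟨i, hi⟩ := hP.exists_dist_lt x hδ
    obtain ⟨z, hz⟩ := hlim i
    obtain ⟨N, hN⟩ := Metric.cauchySeq_iff.1 hz.cauchySeq (ε / 3) (by positivity)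
    have hdist : ∀ n, dist (L n x) (L n (P i)) < ε / 3 := fun n => by
      rw [dist_eq_norm, ← map_sub]
      rw [dist_eq_norm] at hi
      calc ‖L n (x - P i)‖ ≤ C * ‖x - P i‖ := hL n _
        _ ≤ (C + 1) * ‖x - P i‖ := by gcongr; linarith
        _ < (C + 1) * (ε / (3 * (C + 1))) := by gcongr
        _ = ε / 3 := by field_simp
    refine ⟨N, fun a ha b hb => ?_⟩
    have h1 := dist_triangle4 (L a x) (L a (P i)) (L b (P i)) (L b x)
    have h2 := hN a ha b hb
    have h3 := hdist b
    rw [dist_comm] at h3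
    linarith [hdist a]
  choose f hf using fun x => cauchySeq_tendsto_of_complete (hcauchy x)
  have hbound : ∀ x, ‖f x‖ ≤ C * ‖x‖ := fun x =>
    le_of_tendsto (hf x).norm (Eventually.of_forall fun n => hL n x)
  refine ⟨LinearMap.mkContinuous
    { toFun := f
      map_add' := fun x y => tendsto_nhds_unique (hf (x + y)) (by simpa using (hf x).add (hf y))
      map_smul' := fun a x => tendsto_nhds_unique (hf (a • x))
        (by simpa using (hf x).const_smul a) } C hbound, ?_, hf⟩
  exact LinearMap.mkContinuous_norm_le _ hC _

namespace IsStableSemigroup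

variable {X : Type*} [NormedAddCommGroup X] [InnerProductSpace ℂ X] [CompleteSpace X]
  {T : ℝ → X →L[ℂ] X} {M ω : ℝ} {A : X →ₗ.[ℂ] X} {g : ℂ → ℂ} {m : ℝ}

/-- Each resolvent contributes a factor `(1-s)⁻¹`, and these commute with the approximating factors.
The resulting functions decay quadratically with a constant independent of `n`, as dominated
convergence requires. -/
theorem decayCalc_laplaceResolvent_sq (hT : IsStableSemigroup T M ω) (hg : IsBoundedHolo g m)
    (n : ℕ) (y : X) :
    decayCalc T (yosidaApprox g n) (laplaceResolvent T 1 (laplaceResolvent T 1 y)) =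
      decayCalc T (yosidaApprox (regularize g) n) y := by
  have h0 := hg.isDecaying_yosidaApprox n
  have hinv := isBoundedHolo_inv_sub (a := 1) (by simp)
  have h1 := h0.mul_bounded hinv.differentiableOn hinv.norm_le
  have h2 := h1.mul_bounded hinv.differentiableOn hinv.norm_le
  unfold laplaceResolvent
  rw [hT.decayCalc_resolvent h0 (by simp) h1, hT.decayCalc_resolvent h1 (by simp) h2]
  congr 2
  funext s
  simp only [yosidaApprox, regularize]
  ring

theorem tendsto_decayCalc_laplaceResolvent_sq (hT : IsStableSemigroup T M ω)
    (hg : IsBoundedHolo g m) (y : X) :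
    Tendsto (fun n => decayCalc T (yosidaApprox g n)
      (laplaceResolvent T 1 (laplaceResolvent T 1 y))) atTop
      (𝓝 (decayCalc T (regularize g) y)) := by
  simp_rw [hT.decayCalc_laplaceResolvent_sq hg]
  exact hT.tendsto_decayCalc (fun n => hg.isDecaying_regularize.yosidaApprox n)
    hg.isDecaying_regularize (fun s _ => tendsto_yosidaApprox _ s) y

theorem laplaceResolvent_comm (hT : IsStableSemigroup T M ω) {a : ℂ} (ha : 0 < a.re) {t : ℝ}
    (ht : 0 ≤ t) (x : X) : laplaceResolvent T a (T t x) = T t (laplaceResolvent T a x) :=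
  hT.semOp_comm (weightedIntegrable_cexp (by linarith [hT.pos])) ht x

/-- The operators `S t = g(A) T(t)` as strong limits, with their bounds. -/
theorem exists_orbit_limit (hT : IsStableSemigroup T M ω) (hA : IsGenerator A T) :
    ∃ B : ℝ, ∀ (g : ℂ → ℂ) (m : ℝ), IsBoundedHolo g m → ∃ S : ℝ → X →L[ℂ] X,
      (∀ t : ℝ, 0 < t → ‖S t‖ ≤ M * B * m / Real.sqrt t ∧
        ∀ x, Tendsto (fun n => decayCalc T (yosidaApprox g n) (T t x)) atTop (𝓝 (S t x))) ∧
      ∀ x, MemLp (fun t => S t x) 2 (volume.restrict (Set.Ioi 0)) ∧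
        ∫ t in Set.Ioi (0 : ℝ), ‖S t x‖ ^ 2 ≤ B ^ 2 * m ^ 2 * ‖x‖ ^ 2 := by
  obtain ⟨B, hB, hadm⟩ := hT.exists_admissible_bound
  refine ⟨B, fun g m hg => ?_⟩
  have hm := hg.nonneg
  have hM := hT.nonneg
  have hex : ∀ t : ℝ, 0 < t → ∃ L : X →L[ℂ] X, ‖L‖ ≤ M * B * m / Real.sqrt t ∧
      ∀ x, Tendsto (fun n => decayCalc T (yosidaApprox g n) (T t x)) atTop (𝓝 (L x)) := by
    intro t ht
    have hR := hT.denseRange_laplaceResolvent hA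
    -- The dense set is the range of `(1 - A)⁻²`; the two resolvents are moved past `T t` before the
    -- convergence lemma is used.
    refine exists_strong_limit (L := fun n => (decayCalc T (yosidaApprox g n)).comp (T t))
      (fun n x => ?_) (by positivity) (hR.comp hR (laplaceResolvent T 1).continuous) fun y => ?_
    · refine (hT.norm_orbit_le_of_eLpNorm_le (b := B * m * ‖x‖)
        (fun s hs x => hT.decayCalc_comm (hg.isDecaying_yosidaApprox n) hs x) (by positivity)
        (hadm _ _ m (hg.isDecaying_yosidaApprox n) (hg.yosidaApprox n).norm_le x).2 ht).trans_eq ?_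
      ring
    · have hre : 0 < (1 : ℂ).re := by simp
      refine ⟨_, (hT.tendsto_decayCalc_laplaceResolvent_sq hg (T t y)).congr fun n => ?_⟩
      rw [hT.laplaceResolvent_comm hre ht.le, hT.laplaceResolvent_comm hre ht.le]
      rfl
  choose! S hS using hex
  refine ⟨S, hS, fun x => ?_⟩
  have hmeas := fun n => (hadm _ _ m (hg.isDecaying_yosidaApprox n) (hg.yosidaApprox n).norm_le x).1
  have hlim : ∀ᵐ t ∂(volume.restrict (Set.Ioi (0 : ℝ))), Tendsto
      (fun n => decayCalc T (yosidaApprox g n) (T t x)) atTop (𝓝 (S t x)) := by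
    filter_upwards [ae_restrict_mem measurableSet_Ioi] with t ht
    exact (hS t ht).2 x
  have hSm := aestronglyMeasurable_of_tendsto_ae atTop hmeas hlim
  have hle : eLpNorm (fun t => S t x) 2 (volume.restrict (Set.Ioi 0)) ≤
      ENNReal.ofReal (B * m * ‖x‖) := by
    -- Fatou's lemma carries the uniform `L²` bound to the pointwise limit.
    refine (Lp.eLpNorm_lim_le_liminf_eLpNorm hmeas _ hlim).trans ?_
    refine liminf_le_of_frequently_le' (Frequently.of_forall fun n => ?_)
    exact (hadm _ _ m (hg.isDecaying_yosidaApprox n) (hg.yosidaApprox n).norm_le x).2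
  have hmem : MemLp (fun t => S t x) 2 (volume.restrict (Set.Ioi 0)) :=
    ⟨hSm, hle.trans_lt ENNReal.ofReal_lt_top⟩
  refine ⟨hmem, ?_⟩
  rw [hmem.eLpNorm_eq_integral_rpow_norm two_ne_zero ENNReal.ofNat_ne_top,
    ENNReal.ofReal_le_ofReal_iff (by positivity)] at hle
  simp only [ENNReal.toReal_ofNat, Real.rpow_ofNat] at hle
  rw [← one_div, ← Real.sqrt_eq_rpow, Real.sqrt_le_left (by positivity)] at hle
  calc _ ≤ (B * m * ‖x‖) ^ 2 := hle
    _ = _ := by ring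

/-- The operators `g(A) (1 - A)⁻¹` as strong limits. -/
theorem exists_resolvent_limit (hT : IsStableSemigroup T M ω) (hA : IsGenerator A T)
    (hg : IsBoundedHolo g m) :
    ∃ N : X →L[ℂ] X, ∀ x, Tendsto (fun n => decayCalc T (yosidaApprox g n)
      (laplaceResolvent T 1 x)) atTop (𝓝 (N x)) := by
  obtain ⟨B, hB, hadm⟩ := hT.exists_admissible_bound
  have hm := hg.nonneg
  have hM := hT.nonneg
  have hΓ : 0 ≤ Real.Gamma (1 / 2) := (Real.Gamma_pos_of_pos (by norm_num)).le
  have hbound : ∀ n x, ‖decayCalc T (yosidaApprox g n) (laplaceResolvent T 1 x)‖ ≤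
      M * B * m * Real.Gamma (1 / 2) * ‖x‖ := fun n x => by
    refine (hT.norm_semOp_exp_le fun t ht => hT.norm_orbit_le_of_eLpNorm_le
      (b := B * m * ‖x‖)
      (fun s hs x => hT.decayCalc_comm (hg.isDecaying_yosidaApprox n) hs x) (by positivity)
      (hadm _ _ m (hg.isDecaying_yosidaApprox n) (hg.yosidaApprox n).norm_le x).2 ht).trans_eq ?_
    ring
  obtain ⟨N, -, hN⟩ := exists_strong_limit
    (L := fun n => (decayCalc T (yosidaApprox g n)).comp (laplaceResolvent T 1))
    hbound (by positivity) (hT.denseRange_laplaceResolvent hA)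
    (fun y => ⟨_, hT.tendsto_decayCalc_laplaceResolvent_sq hg y⟩)
  exact ⟨N, hN⟩

/-- The operators `g(A) (1 - A)⁻¹` are multiplicative up to a factor `(1 - A)⁻¹`. -/
theorem resolvent_limit_mul (hT : IsStableSemigroup T M ω) {g₁ g₂ : ℂ → ℂ} {m₁ m₂ : ℝ}
    (h₁ : IsBoundedHolo g₁ m₁) (h₂ : IsBoundedHolo g₂ m₂) {N₁ N₂ N₁₂ : X →L[ℂ] X}
    (hN₁ : ∀ x, Tendsto (fun n => decayCalc T (yosidaApprox g₁ n)
      (laplaceResolvent T 1 x)) atTop (𝓝 (N₁ x)))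
    (hN₂ : ∀ x, Tendsto (fun n => decayCalc T (yosidaApprox g₂ n)
      (laplaceResolvent T 1 x)) atTop (𝓝 (N₂ x)))
    (hN₁₂ : ∀ x, Tendsto (fun n => decayCalc T (yosidaApprox (fun s => g₁ s * g₂ s) n)
      (laplaceResolvent T 1 x)) atTop (𝓝 (N₁₂ x))) (y : X) :
    N₂ (laplaceResolvent T 1 y) = laplaceResolvent T 1 (N₂ y) ∧
      N₁₂ (laplaceResolvent T 1 y) = N₁ (N₂ y) := by
  have hcomm : N₂ (laplaceResolvent T 1 y) = laplaceResolvent T 1 (N₂ y) := by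
    refine tendsto_nhds_unique (hN₂ _)
      ((((laplaceResolvent T 1).continuous.tendsto _).comp (hN₂ y)).congr fun n => ?_)
    exact (hT.decayCalc_semOp_comm (h₂.isDecaying_yosidaApprox n)
      (weightedIntegrable_cexp (by simpa using by linarith [hT.pos])) _).symm
  refine ⟨hcomm, ?_⟩
  have e2 : N₂ (laplaceResolvent T 1 y) = decayCalc T (regularize g₂) y :=
    tendsto_nhds_unique (hN₂ _) (hT.tendsto_decayCalc_laplaceResolvent_sq h₂ y)
  have e12 : N₁₂ (laplaceResolvent T 1 y) = decayCalc T (regularize fun s => g₁ s * g₂ s) y :=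
    tendsto_nhds_unique (hN₁₂ _) (hT.tendsto_decayCalc_laplaceResolvent_sq (h₁.mul h₂) y)
  rw [e12]
  -- By commutation, `(1 - A)⁻¹ N₂ y` is `((1-s)⁻² g₂)(A) y`. Applying the approximants of `g₁` to
  -- it multiplies two decaying functions, and the product is the approximant of `(1-s)⁻² g₁ g₂`.
  refine tendsto_nhds_unique ?_ (hN₁ (N₂ y))
  rw [← hcomm, e2]
  have h12 := (h₁.mul h₂).isDecaying_regularize
  refine (hT.tendsto_decayCalc (fun n => h12.yosidaApprox n) h12
    (fun s _ => tendsto_yosidaApprox _ s) y).congr fun n => ?_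
  rw [hT.decayCalc_mul (h₁.isDecaying_yosidaApprox n) h₂.isDecaying_regularize]
  congr 2
  funext s
  simp only [yosidaApprox, regularize]
  ring

/-- The approximants of the constant function `1` converge to the identity. -/
theorem resolvent_limit_one (hT : IsStableSemigroup T M ω) {N : X →L[ℂ] X}
    (hN : ∀ x, Tendsto (fun n => decayCalc T (yosidaApprox (fun _ => 1) n)
      (laplaceResolvent T 1 x)) atTop (𝓝 (N x))) (x : X) : N x = laplaceResolvent T 1 x := by
  have h1 : IsBoundedHolo (fun _ => 1) 1 := ⟨differentiableOn_const 1, fun s _ => by simp⟩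
  have hre : 0 < (1 : ℂ).re := by simp
  have hu : ∀ t : ℝ, 0 < t → Tendsto (fun n => decayCalc T (yosidaApprox (fun _ => 1) n)
      (T t (laplaceResolvent T 1 x))) atTop (𝓝 (N (T t x))) := fun t ht => by
    rw [← hT.laplaceResolvent_comm hre ht.le]
    exact hN _
  -- The Toeplitz operator with symbol `1` is the identity. This shows `N T(t)x = T(t)(1 - A)⁻¹x`
  -- for almost every `t > 0` without computing any kernel; continuity in `t` and `t ↓ 0` finish.
  obtain ⟨F, G, hF, hG, hGu⟩ := hT.isToeplitzImage h1 (b := fun _ => 1)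
    (Eventually.of_forall fun _ => tendsto_const_nhds) hu
  have hFG : G = F := by
    apply (Lp.fourierTransformₗᵢ ℝ X).injective
    refine Lp.ext (hG.trans (Eventually.of_forall fun ξ => ?_))
    simp only [one_smul]
    rfl
  have hae : (fun t => N (T t x)) =ᵐ[volume.restrict (Set.Ioi 0)]
      fun t => T t (laplaceResolvent T 1 x) := by
    filter_upwards [hGu, ae_restrict_of_ae hF, ae_restrict_mem measurableSet_Ioi] with t h1 h2 h3
    rw [← h1, hFG, h2, Set.indicator_of_mem h3]
  have hc : ∀ z, ContinuousOn (fun t => T t z) (Set.Ioi 0) := fun z =>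
    (hT.continuousOn z).mono Set.Ioi_subset_Ici_self
  have heq := Measure.eqOn_open_of_ae_eq hae isOpen_Ioi
    (N.continuous.comp_continuousOn (hc x)) (hc _)
  have hlim : ∀ z, Tendsto (fun t => T t z) (𝓝[>] 0) (𝓝 z) := fun z => by
    have := ((hT.continuousOn z) 0 Set.self_mem_Ici).mono_left
      (nhdsWithin_mono 0 Set.Ioi_subset_Ici_self)
    simpa [hT.map_zero] using this
  refine tendsto_nhds_unique ((N.continuous.tendsto _).comp (hlim x)) ?_
  refine (hlim (laplaceResolvent T 1 x)).congr' ?_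
  filter_upwards [self_mem_nhdsWithin] with t ht
  exact (heq ht).symm

end IsStableSemigroup

end StrongLimits

/-! ### Bounded analytic functions as functions on the whole plane. -/

section Extension

/-- The extension of a bounded analytic function on the left half-plane by zero. -/
noncomputable def hInfExtend (g : HInfMinus) (s : ℂ) : ℂ :=
  open Classical in if h : s ∈ leftHalfPlane then g.1 ⟨s, h⟩ else 0

theorem hInfExtend_of_neg (g : HInfMinus) {s : ℂ} (h : s ∈ leftHalfPlane) :
    hInfExtend g s = g.1 ⟨s, h⟩ := dif_pos h

theorem isBoundedHolo_hInfExtend (g : HInfMinus) : IsBoundedHolo (hInfExtend g) (hInfNorm g) := by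
  obtain ⟨⟨G, hG, hgG⟩, C, hC⟩ := g.2
  refine ⟨hG.congr fun s hs => ?_, fun s hs => ?_⟩
  · rw [hInfExtend_of_neg g hs]; exact hgG ⟨s, hs⟩
  · rw [hInfExtend_of_neg g hs]
    exact le_ciSup (f := fun s : leftHalfPlane => ‖g.1 s‖)
      ⟨C, by rintro _ ⟨s, rfl⟩; exact hC s⟩ ⟨s, hs⟩

theorem hInfExtend_add (g₁ g₂ : HInfMinus) (s : ℂ) :
    hInfExtend (g₁ + g₂) s = hInfExtend g₁ s + hInfExtend g₂ s := by
  by_cases h : s ∈ leftHalfPlane <;> simp [hInfExtend, h]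

theorem hInfExtend_smul (a : ℂ) (g : HInfMinus) (s : ℂ) :
    hInfExtend (a • g) s = a * hInfExtend g s := by
  by_cases h : s ∈ leftHalfPlane <;> simp [hInfExtend, h]

theorem hInfExtend_mul (g₁ g₂ : HInfMinus) :
    hInfExtend (g₁ * g₂) = fun s => hInfExtend g₁ s * hInfExtend g₂ s := by
  funext s
  by_cases h : s ∈ leftHalfPlane <;> simp [hInfExtend, h]

theorem IsBoundaryFunction.tendsto_extend {g : HInfMinus} {b : ℝ → ℂ}
    (hb : IsBoundaryFunction g b) :
    ∀ᵐ w : ℝ, Tendsto (fun j : ℕ => hInfExtend g (-(1 / ((j : ℝ) + 1) : ℝ) + w * Complex.I))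
      atTop (𝓝 (b w)) := by
  filter_upwards [hb] with w hw
  have hpos : ∀ j : ℕ, (0 : ℝ) < 1 / ((j : ℝ) + 1) := fun j => by positivity
  have hlim : Tendsto (fun j : ℕ => (⟨1 / ((j : ℝ) + 1), hpos j⟩ : Set.Ioi (0 : ℝ))) atTop
      (comap Subtype.val (𝓝 0)) :=
    tendsto_comap_iff.2 tendsto_one_div_add_atTop_nhds_zero_nat
  refine (hw.comp hlim).congr fun j => ?_
  rw [hInfExtend_of_neg]
  rfl

end Extension

/-! ### The functional calculus on the domain of the generator. -/

section Main

variable {X : Type*} [NormedAddCommGroup X] [InnerProductSpace ℂ X]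
  {T : ℝ → X →L[ℂ] X} {M ω : ℝ} {A : X →ₗ.[ℂ] X}

theorem IsExponentiallyStable.exists_isStableSemigroup (h : IsExponentiallyStable T)
    (hT : IsC0Semigroup T) : ∃ M ω, IsStableSemigroup T M ω :=
  let ⟨M, ω, hω, hM⟩ := h
  ⟨M, ω, hT, hω, hM⟩

theorem IsResolventAt.apply_sub {R : X →L[ℂ] X} (hR : IsResolventAt A 1 R) (x : A.domain) :
    R ((x : X) - A x) = x := by
  simpa using hR.2 x

/-- The linear map `g ↦ g(A)`, as a limit of `k(A)` for the approximants `k` of `g`. -/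
theorem IsStableSemigroup.exists_calculus [CompleteSpace X] (hT : IsStableSemigroup T M ω)
    (hA : IsGenerator A T) :
    ∃ (Φ : HInfMinus →ₗ[ℂ] (A.domain →ₗ[ℂ] X)) (N : HInfMinus → X →L[ℂ] X),
      (∀ g x, Φ g x = N g ((x : X) - A x)) ∧
      ∀ g x, Tendsto (fun n => decayCalc T (yosidaApprox (hInfExtend g) n) (laplaceResolvent T 1 x))
        atTop (𝓝 (N g x)) := by
  choose N hN using fun g : HInfMinus => hT.exists_resolvent_limit hA (isBoundedHolo_hInfExtend g)
  refine ⟨{ toFun := fun g => (N g).toLinearMap ∘ₗ (A.domain.subtype - A.toFun)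
            map_add' := fun g₁ g₂ => ?_
            map_smul' := fun a g => ?_ }, N, fun g x => rfl, hN⟩
  · refine LinearMap.ext fun x => tendsto_nhds_unique (hN _ _) ?_
    refine ((hN g₁ _).add (hN g₂ _)).congr fun n => ?_
    rw [← hT.decayCalc_add ((isBoundedHolo_hInfExtend g₁).isDecaying_yosidaApprox n)
      ((isBoundedHolo_hInfExtend g₂).isDecaying_yosidaApprox n)]
    congr 2
    funext s
    simp only [yosidaApprox, hInfExtend_add, mul_add]
  · refine LinearMap.ext fun x => tendsto_nhds_unique (hN _ _) ?_
    refine ((hN g _).const_smul a).congr fun n => ?_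
    rw [← hT.decayCalc_const_mul ((isBoundedHolo_hInfExtend g).isDecaying_yosidaApprox n)]
    congr 2
    funext s
    simp only [yosidaApprox, hInfExtend_smul]
    ring

/-- Every `x ∈ D(A)` equals `(1 - A)⁻¹(x - Ax)`, so identities between the operators `N g` become
identities between the operators `Φ g`. -/
theorem isHInfCalculus_of_limit [CompleteSpace X] (hT : IsStableSemigroup T M ω)
    (hA : IsGenerator A T)
    {Φ : HInfMinus →ₗ[ℂ] (A.domain →ₗ[ℂ] X)} {N : HInfMinus → X →L[ℂ] X}
    (hΦ : ∀ g x, Φ g x = N g ((x : X) - A x))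
    (hN : ∀ g x, Tendsto (fun n => decayCalc T (yosidaApprox (hInfExtend g) n)
      (laplaceResolvent T 1 x)) atTop (𝓝 (N g x))) : IsHInfCalculus A Φ := by
  have hR := hT.isResolventAt hA (a := 1) (by simp)
  have hone : ∀ n (x : X), decayCalc T (yosidaApprox (hInfExtend (1 : HInfMinus)) n) x =
      decayCalc T (yosidaApprox (fun _ => 1) n) x := fun n x => by
    rw [decayCalc_congr T fun s hs => ?_]
    have h1 : hInfExtend (1 : HInfMinus) s = 1 := hInfExtend_of_neg 1 hs
    simp only [yosidaApprox, h1]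
  have hN1 : ∀ x, Tendsto (fun n => decayCalc T (yosidaApprox (fun _ => 1) n)
      (laplaceResolvent T 1 x)) atTop (𝓝 (N 1 x)) := fun x =>
    (hN 1 x).congr fun n => hone n _
  have hmap_one : ∀ x : A.domain, Φ 1 x = x := fun x => by
    rw [hΦ, hT.resolvent_limit_one hN1, hR.apply_sub]
  refine ⟨hmap_one, fun a ha => ⟨laplaceResolvent T a, hT.isResolventAt hA ha, fun x => ?_⟩,
    fun g₁ g₂ x hAx => ?_⟩
  · have h1 : IsBoundedHolo (fun _ => 1) 1 := ⟨differentiableOn_const 1, fun s _ => by simp⟩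
    have hk := fun n => h1.isDecaying_yosidaApprox n
    have hinv := isBoundedHolo_inv_sub ha
    -- The approximants of `1/(a-s)` are `1/(a-s)` times those of `1`, so this case reduces to
    -- `hmap_one`.
    have hcomm : ∀ n (y : X), decayCalc T (yosidaApprox (hInfExtend (invSubFun a ha)) n) y =
        laplaceResolvent T a (decayCalc T (yosidaApprox (fun _ => 1) n) y) := fun n y => by
      have e1 := hT.decayCalc_resolvent (hk n) ha
        ((hk n).mul_bounded hinv.differentiableOn hinv.norm_le) y
      have e2 := hT.decayCalc_semOp_comm (hk n)
        (weightedIntegrable_cexp (by linarith [hT.pos] : -ω < a.re)) y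
      rw [laplaceResolvent, ← e2, e1, decayCalc_congr T fun s hs => ?_]
      have h2 : hInfExtend (invSubFun a ha) s = (a - s)⁻¹ := hInfExtend_of_neg _ hs
      simp only [yosidaApprox, h2]
      ring
    have hlim := ((laplaceResolvent T a).continuous.tendsto _).comp (hN1 ((x : X) - A x))
    rw [← hΦ, hmap_one] at hlim
    rw [hΦ]
    refine tendsto_nhds_unique (hN _ _) (hlim.congr fun n => ?_)
    rw [hcomm]
    rfl
  -- For `x ∈ D(A²)` the vector `z = (1 - A)x` is again in `D(A)`, hence in the range of the
  -- resolvent. This supplies the extra factor `(1 - A)⁻¹` that `resolvent_limit_mul` needs.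
  · let z : A.domain := ⟨(x : X) - A x, A.domain.sub_mem x.2 hAx⟩
    have hz : laplaceResolvent T 1 ((z : X) - A z) = z := hR.apply_sub z
    obtain ⟨h1, h2⟩ := hT.resolvent_limit_mul (isBoundedHolo_hInfExtend g₁)
      (isBoundedHolo_hInfExtend g₂) (hN g₁) (hN g₂)
      (N₁₂ := N (g₁ * g₂)) (by simpa only [hInfExtend_mul] using hN (g₁ * g₂))
      ((z : X) - A z)
    obtain ⟨hmem, hsub⟩ := hR.1 (N g₂ ((z : X) - A z))
    have hval : Φ g₂ x = laplaceResolvent T 1 (N g₂ ((z : X) - A z)) := by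
      rw [hΦ, ← h1, hz]
    have hmem' : Φ g₂ x ∈ A.domain := hval ▸ hmem
    refine ⟨hmem', ?_⟩
    have heq : (⟨Φ g₂ x, hmem'⟩ : A.domain) = ⟨_, hmem⟩ := Subtype.ext hval
    rw [heq, hΦ g₁, hΦ]
    rw [one_smul] at hsub
    rw [hsub, ← h2, hz]

end Main

theorem theorem1 {X : Type*} [NormedAddCommGroup X] [InnerProductSpace ℂ X] [CompleteSpace X]
    [TopologicalSpace.SeparableSpace X]
    (A : X →ₗ.[ℂ] X) (T : ℝ → X →L[ℂ] X)
    (hT : IsC0Semigroup T) (hA : IsGenerator A T) (hstable : IsExponentiallyStable T) :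
    ∃ (Φ : HInfMinus →ₗ[ℂ] (A.domain →ₗ[ℂ] X)) (γA γ : ℝ),
      IsHInfCalculus A Φ ∧
      ∀ g : HInfMinus,
        IsBoundedOnDomain (Φ g) ∧
        IsAdmissibleWith T (Φ g) (γA * hInfNorm g ^ 2) ∧
        ∃ S : ℝ → X →L[ℂ] X,
          (∀ t : ℝ, 0 < t →
            (∀ x : A.domain, S t x = applyOnDomain (Φ g) (T t x)) ∧
            ‖S t‖ ≤ γ * hInfNorm g / Real.sqrt t) ∧
          (∀ x : X,
            MemLp (fun t : ℝ => S t x) 2 (volume.restrict (Set.Ioi (0 : ℝ))) ∧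
            ∫ t in Set.Ioi (0 : ℝ), ‖S t x‖ ^ 2 ≤ γA * hInfNorm g ^ 2 * ‖x‖ ^ 2) ∧
          ∀ b : ℝ → ℂ, IsBoundaryFunction g b → ∀ x : X,
            IsToeplitzImage b (fun t => T t x) (fun t => S t x) := by
  obtain ⟨M, ω, hS⟩ := hstable.exists_isStableSemigroup hT
  obtain ⟨Φ, N, hΦ, hN⟩ := hS.exists_calculus hA
  obtain ⟨B, hB⟩ := hS.exists_orbit_limit hA
  have hR := hS.isResolventAt hA (a := 1) (by simp)
  -- `B` is the constant of the `L²` estimate, squared for the integral; the factor `M` enters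
  -- through the `t^{-1/2}` bound.
  refine ⟨Φ, B ^ 2, M * B, isHInfCalculus_of_limit hS hA hΦ hN, fun g => ?_⟩
  obtain ⟨S, hSlim, hSL2⟩ := hB _ _ (isBoundedHolo_hInfExtend g)
  have hagree : ∀ t : ℝ, 0 < t → ∀ x : A.domain, S t x = applyOnDomain (Φ g) (T t x) := by
    intro t ht x
    have hmem := hA.apply_mem_domain hT x.2 ht.le
    rw [applyOnDomain, dif_pos hmem, hΦ]
    -- Both operators are limits of the same approximants, since `T t x = (1 - A)⁻¹(1 - A) T t x` on
    -- the domain.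
    refine tendsto_nhds_unique ((hSlim t ht).2 x) ((hN g _).congr fun n => ?_)
    rw [hR.apply_sub ⟨T t x, hmem⟩]
  have hae : ∀ x : A.domain, (fun t => S t x) =ᵐ[volume.restrict (Set.Ioi 0)]
      fun t => applyOnDomain (Φ g) (T t x) := fun x => by
    filter_upwards [ae_restrict_mem measurableSet_Ioi] with t ht
    exact hagree t ht x
  refine ⟨⟨‖N g‖, fun x => ?_⟩, fun x => ⟨(hSL2 x).1.ae_eq (hae x), ?_⟩, S,
    fun t ht => ⟨hagree t ht, (hSlim t ht).1⟩, hSL2, fun b hb x => ?_⟩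
  · rw [hΦ]
    exact ((N g).le_opNorm _).trans (mul_le_mul_of_nonneg_left (norm_sub_le _ _) (norm_nonneg _))
  · rw [← integral_congr_ae ((hae x).mono fun t ht => by
      simpa using congrArg (fun v : X => ‖v‖ ^ 2) ht)]
    exact (hSL2 x).2
  · exact hS.isToeplitzImage (isBoundedHolo_hInfExtend g) hb.tendsto_extend
      fun t ht => (hSlim t ht).2 x
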